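/- Let $G$ be a connected (real, finite-dimensional) Lie group of dimension $n$ with identity $e$ and Lie algebra $\mathfrak g=T_eG$, and let $\Pi$ be a Poisson-Lie structure on $G$, that is, a smooth $2$-vector field whose bracket $\{F,K\}=\Pi(\mathrm dF,\mathrm dK)$ on $C^\infty(G)$ satisfies the Jacobi identity and which is multiplicative: $\Pi(gh)=(L_g)_*\Pi(h)+(R_h)_*\Pi(g)$ for all $g,h\in G$. For $F\in C^\infty(G)$ let $X_F^\Pi$ be the Hamiltonian vector field, given by $\langle\beta,X_F^\Pi(g)\rangle=\Pi(g)(\mathrm dF(g),\beta)$ for $\beta\in T_g^*G$. Let $\mathfrak g^*$ carry the Lie bracket dual to $\delta=\mathrm d_e\Pi:\mathfrak g\to\wedge^2\mathfrak g$, i.e. $[\alpha,\beta]_{\mathfrak g^*}(\xi)=\delta(\xi)(\alpha,\beta)$; it is called unimodular if $\operatorname{Tr}(\mathrm{ad}_\alpha)=0$ for every $\alpha\in\mathfrak g^*$. Let $f_0(g)=\det(\mathrm{Ad}^n_g)$, where $\mathrm{Ad}^n_g$ is the adjoint action of $g\in G$ on $\wedge^n\mathfrak g$, and for $\nu\in\wedge^n\mathfrak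 g^*$ let $\nu^l$ be the left-invariant $n$-form on $G$ with $\nu^l(e)=\nu$. A volume form is a smooth nowhere vanishing $n$-form, and a vector field $X$ preserves a form $\Phi$ if $\mathcal L_X\Phi=0$. Let $H\in C^\infty(G)$ be Morse at $e$: $\mathrm dH(e)=0$ and the Hessian $(\mathrm{Hess}\,H)(e)(\xi,\eta)=\xi(X^\eta(H))$ on $\mathfrak g$, where $X^\eta$ is any vector field with $X^\eta(e)=\eta$, is nondegenerate. If $X_H^\Pi$ preserves some volume form $\Phi$ on $G$, then the dual Lie algebra $\mathfrak g^*$ is unimodular and, for every $\nu\in\wedge^n\mathfrak g^*$ with $\nu\neq0$, $\sqrt{f_0}\,\nu^l$ is a volume form on $G$ that is preserved by all Hamiltonian vector fields $X_F^\Pi$, $F\in C^\infty(G)$. -/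

import Mathlib

set_option maxSynthPendingDepth 3

open scoped Manifold ContDiff

namespace PoissonLie

noncomputable section

/-! ### Contravariant `2`-tensors on a vector space

A contravariant `2`-tensor on `V` is a bilinear form on the dual `V*`; the bivectors (elements of
`⋀² V`) are the alternating ones. -/

section Linear

variable {V : Type*} [AddCommGroup V] [Module ℝ V] [TopologicalSpace V]
  {W : Type*} [AddCommGroup W] [Module ℝ W] [TopologicalSpace W]

/-- Push-forward of a `2`-tensor along a linear map `A`: `(A_* P)(α, β) = P(α ∘ A, β ∘ A)`. -/
def push (A : V →L[ℝ] W) (P : (V →L[ℝ] ℝ) →L[ℝ] (V →L[ℝ] ℝ) →L[ℝ] ℝ) :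
    (W →L[ℝ] ℝ) →L[ℝ] (W →L[ℝ] ℝ) →L[ℝ] ℝ :=
  (ContinuousLinearMap.precomp ℝ (ContinuousLinearMap.precomp ℝ A)).comp
    (P.comp (ContinuousLinearMap.precomp ℝ A))

@[simp]
theorem push_apply (A : V →L[ℝ] W) (P : (V →L[ℝ] ℝ) →L[ℝ] (V →L[ℝ] ℝ) →L[ℝ] ℝ)
    (α β : W →L[ℝ] ℝ) :
    push A P α β = P (α.comp A) (β.comp A) := rfl

/-- The map `P^♯ : V* → V` with `⟨P^♯ α, β⟩ = P(α, β)`, see `apply_sharp`. -/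
def sharp [IsTopologicalAddGroup V] [ContinuousSMul ℝ V] [T2Space V]
    [FiniteDimensional ℝ V] (P : (V →L[ℝ] ℝ) →L[ℝ] (V →L[ℝ] ℝ) →L[ℝ] ℝ) (α : V →L[ℝ] ℝ) : V :=
  (Module.evalEquiv ℝ V).symm
    ((P α : (V →L[ℝ] ℝ) →ₗ[ℝ] ℝ) ∘ₗ
      (LinearMap.toContinuousLinearMap : (V →ₗ[ℝ] ℝ) ≃ₗ[ℝ] (V →L[ℝ] ℝ)).toLinearMap)

theorem apply_sharp [IsTopologicalAddGroup V] [ContinuousSMul ℝ V] [T2Space V]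
    [FiniteDimensional ℝ V] (P : (V →L[ℝ] ℝ) →L[ℝ] (V →L[ℝ] ℝ) →L[ℝ] ℝ) (α β : V →L[ℝ] ℝ) :
    β (sharp P α) = P α β := by
  have h := Module.apply_evalEquiv_symm_apply ℝ V (β : V →ₗ[ℝ] ℝ)
    ((P α : (V →L[ℝ] ℝ) →ₗ[ℝ] ℝ) ∘ₗ
      (LinearMap.toContinuousLinearMap : (V →ₗ[ℝ] ℝ) ≃ₗ[ℝ] (V →L[ℝ] ℝ)).toLinearMap)
  exact h

end Linear

/-! ### Tensor fields on a manifold -/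

section Manifold

variable {E : Type*} [NormedAddCommGroup E] [NormedSpace ℝ E]
  {M : Type*} [TopologicalSpace M] [ChartedSpace E M]

/-- The tangent space `T_x M`. -/
abbrev Tan (E : Type*) [NormedAddCommGroup E] [NormedSpace ℝ E]
    {M : Type*} [TopologicalSpace M] [ChartedSpace E M] (x : M) : Type _ :=
  TangentSpace 𝓘(ℝ, E) x

instance instFiniteDimensionalTan [FiniteDimensional ℝ E] (x : M) :
    FiniteDimensional ℝ (TangentSpace 𝓘(ℝ, E) x) :=
  inferInstanceAs (FiniteDimensional ℝ E)

instance instT2SpaceTan (x : M) : T2Space (TangentSpace 𝓘(ℝ, E) x) :=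
  inferInstanceAs (T2Space E)

/-- Fields of contravariant `2`-tensors: at each `x`, a bilinear form on the cotangent space
`T_x^* M`. The `2`-vector fields (sections of `⋀² TM`) are the alternating ones. -/
abbrev TensorField2 (E : Type*) [NormedAddCommGroup E] [NormedSpace ℝ E]
    (M : Type*) [TopologicalSpace M] [ChartedSpace E M] : Type _ :=
  ∀ x : M, (Tan E x →L[ℝ] ℝ) →L[ℝ] (Tan E x →L[ℝ] ℝ) →L[ℝ] ℝ

/-- Smooth real functions on `M`. -/
def IsSmoothFun (E : Type*) [NormedAddCommGroup E] [NormedSpace ℝ E]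
    {M : Type*} [TopologicalSpace M] [ChartedSpace E M] (F : M → ℝ) : Prop :=
  ContMDiff 𝓘(ℝ, E) 𝓘(ℝ, ℝ) ∞ F

/-- The differential `dF(x) ∈ T_x^* M`. -/
def diff (E : Type*) [NormedAddCommGroup E] [NormedSpace ℝ E]
    {M : Type*} [TopologicalSpace M] [ChartedSpace E M] (F : M → ℝ) (x : M) :
    Tan E x →L[ℝ] ℝ :=
  mfderiv 𝓘(ℝ, E) 𝓘(ℝ, ℝ) F x

/-- Smooth vector fields on `M`. -/
def IsSmoothVectorField [IsManifold 𝓘(ℝ, E) 1 M] (X : ∀ x : M, Tan E x) : Prop :=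
  ContMDiff 𝓘(ℝ, E) 𝓘(ℝ, E).tangent ∞
    (fun x => (⟨x, X x⟩ : TangentBundle 𝓘(ℝ, E) M))

/-- The bracket `{F, K} = P(dF, dK)` of two functions. -/
def bracket (P : TensorField2 E M) (F K : M → ℝ) (x : M) : ℝ :=
  P x (diff E F x) (diff E K x)

/-- `P` is a Poisson structure: a `2`-vector field (alternating at every point, and smooth in the
sense that `{F, K}` is smooth for smooth `F, K`) whose bracket satisfies the Jacobi identity. -/
structure IsPoisson (P : TensorField2 E M) : Prop where
  alternating : ∀ (x : M) (α : Tan E x →L[ℝ] ℝ), P x α α = 0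
  smooth : ∀ F K : M → ℝ, IsSmoothFun E F → IsSmoothFun E K → IsSmoothFun E (bracket P F K)
  jacobi : ∀ F K L : M → ℝ, IsSmoothFun E F → IsSmoothFun E K → IsSmoothFun E L → ∀ x,
    bracket P F (bracket P K L) x + bracket P K (bracket P L F) x
      + bracket P L (bracket P F K) x = 0

/-- The Hamiltonian vector field `X_F(x) = P^♯(dF(x))`. -/
def hamiltonian [FiniteDimensional ℝ E] (P : TensorField2 E M) (F : M → ℝ) (x : M) :
    Tan E x :=
  sharp (P x) (diff E F x)

/-- `Φ` is a volume form: a smooth, nowhere vanishing differential form of top degree.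
Smoothness means that `Φ(Y₁, …, Yₙ)` is smooth for all smooth vector fields `Yᵢ`. -/
structure IsVolumeForm [IsManifold 𝓘(ℝ, E) 1 M] {n : ℕ}
    (Φ : ∀ x : M, Tan E x [⋀^Fin n]→ₗ[ℝ] ℝ) : Prop where
  top_degree : n = Module.finrank ℝ E
  smooth : ∀ Y : Fin n → ∀ x : M, Tan E x, (∀ i, IsSmoothVectorField (Y i)) →
    IsSmoothFun E (fun x => Φ x (fun i => Y i x))
  ne_zero : ∀ x, Φ x ≠ 0

/-- The value at `x` of the Lie derivative of `Φ` along `X` on vector fields `Y₁, …, Yₙ`: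
`(ℒ_X Φ)(Y₁, …, Yₙ) = X(Φ(Y₁, …, Yₙ)) - ∑ᵢ Φ(Y₁, …, [X, Yᵢ], …, Yₙ)`. -/
def lieDerivative {n : ℕ} (X : ∀ x : M, Tan E x) (Φ : ∀ x : M, Tan E x [⋀^Fin n]→ₗ[ℝ] ℝ)
    (Y : Fin n → ∀ x : M, Tan E x) (x : M) : ℝ :=
  diff E (fun y => Φ y (fun i => Y i y)) x (X x)
    - ∑ i, Φ x (Function.update (fun j => Y j x) i
        (VectorField.mlieBracket 𝓘(ℝ, E) X (Y i) x))

/-- `X` preserves `Φ`: `ℒ_X Φ = 0`. -/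
def Preserves [IsManifold 𝓘(ℝ, E) 1 M] {n : ℕ} (X : ∀ x : M, Tan E x)
    (Φ : ∀ x : M, Tan E x [⋀^Fin n]→ₗ[ℝ] ℝ) : Prop :=
  ∀ Y : Fin n → ∀ x : M, Tan E x, (∀ i, IsSmoothVectorField (Y i)) →
    ∀ x, lieDerivative X Φ Y x = 0

end Manifold

/-! ### Lie groups -/

section LieGroup

variable {E : Type*} [NormedAddCommGroup E] [NormedSpace ℝ E]
  {G : Type*} [TopologicalSpace G] [ChartedSpace E G] [Group G]

/-- The Lie algebra `𝔤 = T_e G`. -/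
abbrev LieAlg (E : Type*) [NormedAddCommGroup E] [NormedSpace ℝ E]
    (G : Type*) [TopologicalSpace G] [ChartedSpace E G] [Group G] : Type _ :=
  Tan E (1 : G)

/-- The dual `𝔤*`. -/
abbrev DualLieAlg (E : Type*) [NormedAddCommGroup E] [NormedSpace ℝ E]
    (G : Type*) [TopologicalSpace G] [ChartedSpace E G] [Group G] : Type _ :=
  LieAlg E G →L[ℝ] ℝ

/-- The differential at `h` of the left translation `L_g`. -/
def dL (g h : G) : Tan E h →L[ℝ] Tan E (g * h) :=
  mfderiv 𝓘(ℝ, E) 𝓘(ℝ, E) (fun x => g * x) h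

/-- The differential at `g` of the right translation `R_h`. -/
def dR (h g : G) : Tan E g →L[ℝ] Tan E (g * h) :=
  mfderiv 𝓘(ℝ, E) 𝓘(ℝ, E) (fun x => x * h) g

/-- The differential at `g` of the left translation by `g⁻¹`, as a map `T_g G → T_e G`. -/
def toLieAlg (g : G) : Tan E g →L[ℝ] LieAlg E G :=
  mfderiv 𝓘(ℝ, E) 𝓘(ℝ, E) (fun x => g⁻¹ * x) g

/-- The adjoint action of `G` on `𝔤`. -/
def Ad (g : G) : LieAlg E G →L[ℝ] LieAlg E G :=
  mfderiv 𝓘(ℝ, E) 𝓘(ℝ, E) (fun x => g * x * g⁻¹) 1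

/-- A Poisson-Lie structure: a Poisson structure with
`Π(gh) = (L_g)_* Π(h) + (R_h)_* Π(g)` for all `g, h`. -/
structure IsPoissonLie (P : TensorField2 E G) : Prop where
  poisson : IsPoisson P
  multiplicative : ∀ g h : G, P (g * h) = push (dL g h) (P h) + push (dR h g) (P g)

/-- The field `P` read in the trivialization of the tangent bundle by left translations, a map
from `G` to the fixed space of `2`-tensors on `T_e G` (whose underlying normed space is `E`). -/
def leftTriv (P : TensorField2 E G) (g : G) : (E →L[ℝ] ℝ) →L[ℝ] (E →L[ℝ] ℝ) →L[ℝ] ℝ :=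
  push (toLieAlg g) (P g)

/-- The intrinsic differential `δ = d_e P : 𝔤 → ⋀² 𝔤`; because `P(e) = 0` for a Poisson-Lie
structure, it does not depend on the trivialization used to compute it. -/
def cobracket (P : TensorField2 E G) : LieAlg E G →L[ℝ]
    ((E →L[ℝ] ℝ) →L[ℝ] (E →L[ℝ] ℝ) →L[ℝ] ℝ) :=
  mfderiv 𝓘(ℝ, E) 𝓘(ℝ, (E →L[ℝ] ℝ) →L[ℝ] (E →L[ℝ] ℝ) →L[ℝ] ℝ) (leftTriv P) (1 : G)

/-- The bracket on `𝔤*` dual to `δ`: `[α, β](ξ) = δ(ξ)(α, β)`. -/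
def dualBracket [FiniteDimensional ℝ E] (P : TensorField2 E G) (α β : DualLieAlg E G) :
    DualLieAlg E G :=
  LinearMap.toContinuousLinearMap
    { toFun := fun ξ => cobracket P ξ α β
      map_add' := fun ξ η => by rw [map_add]; rfl
      map_smul' := fun c ξ => by rw [map_smul]; rfl }

theorem dualBracket_apply [FiniteDimensional ℝ E] (P : TensorField2 E G)
    (α β : DualLieAlg E G) (ξ : LieAlg E G) :
    dualBracket P α β ξ = cobracket P ξ α β := rfl

/-- The endomorphism `ad_α = [α, ·]` of `𝔤*`. -/
def dualAd [FiniteDimensional ℝ E] (P : TensorField2 E G) (α : DualLieAlg E G) :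
    DualLieAlg E G →ₗ[ℝ] DualLieAlg E G where
  toFun β := dualBracket P α β
  map_add' β γ := ContinuousLinearMap.ext fun ξ => map_add (cobracket P ξ α) β γ
  map_smul' c β := ContinuousLinearMap.ext fun ξ => map_smul (cobracket P ξ α) c β

/-- `𝔤*` is unimodular: its modular character `α ↦ tr(ad_α)` vanishes. -/
def IsUnimodularDual [FiniteDimensional ℝ E] (P : TensorField2 E G) : Prop :=
  ∀ α : DualLieAlg E G, LinearMap.trace ℝ (DualLieAlg E G) (dualAd P α) = 0

/-- The bilinear form `Hess H (e)(ξ, η) = ξ(X^η(H))`, with the left-invariant `X^η` as vector field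
extending `η`; when `dH(e) = 0` every extension gives the same value. -/
def hessian (H : G → ℝ) (ξ η : LieAlg E G) : ℝ :=
  diff E (fun g => diff E H g (mulInvariantVectorField η g)) 1 ξ

/-- `H` is Morse at `e`: `H` is smooth, `dH(e) = 0` and `Hess H (e)` is nondegenerate. -/
structure IsMorseAtOne (E : Type*) [NormedAddCommGroup E] [NormedSpace ℝ E]
    {G : Type*} [TopologicalSpace G] [ChartedSpace E G] [Group G] (H : G → ℝ) : Prop where
  smooth : IsSmoothFun E H
  critical : diff E H 1 = 0
  separatingLeft : ∀ ξ : LieAlg E G, (∀ η, hessian H ξ η = 0) → ξ = 0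
  separatingRight : ∀ η : LieAlg E G, (∀ ξ, hessian H ξ η = 0) → η = 0

/-- `f₀(g) = det(Ad_g^n)`, the determinant of the adjoint action of `g` on `⋀ⁿ 𝔤`. -/
def f₀ (E : Type*) [NormedAddCommGroup E] [NormedSpace ℝ E]
    {G : Type*} [TopologicalSpace G] [ChartedSpace E G] [Group G] (n : ℕ) (g : G) : ℝ :=
  LinearMap.det (exteriorPower.map n (Ad (E := E) g).toLinearMap)

/-- The left-invariant form `ν^l` with `ν^l(e) = ν`. -/
def leftForm {n : ℕ} (ν : LieAlg E G [⋀^Fin n]→ₗ[ℝ] ℝ) (g : G) : Tan E g [⋀^Fin n]→ₗ[ℝ] ℝ :=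
  ν.compLinearMap (toLieAlg (E := E) g).toLinearMap

end LieGroup

end

end PoissonLie

set_option linter.unusedSectionVars false

/-! Everything is read in the left trivialization of `TG` as `G × 𝔤`. Let `π = leftTriv P`, let `x_F
= π^♯ dF` be the trivialized Hamiltonian field and `χ(α) = tr ad_α` the modular character of `𝔤*`
(`modChar`). For `ν ≠ 0`, a field `x` preserves `ρ ν^l` exactly when `dρ(x) + ρ (tr Dx - tr ad_x) =
0` (`lieDerivative_smul_leftForm`), so the point is to compute `tr D x_F`.

Differentiating `π^♯ dF` produces two traces. Since `π` is alternating, `tr(π^♯ ∘ D²F)` sees only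
the antisymmetric part of the left-invariant second derivative, which is half of `dF ∘ [·,·]`; it
equals `τ/2` with `τ = tr(ξ ↦ π^♯(dF ∘ ad_ξ))` (`lieTrace`). The trace of `ξ ↦ (D_ξ π)^♯ dF` follows
from multiplicativity in two ways: differentiating `π(gh)` at `h = e` gives `χ(dF) - τ + tr
ad_{x_F}`, and differentiating `π(g h g⁻¹)` gives `χ(dF ∘ Ad_{g⁻¹})`. Hence `tr D x_F = χ(dF) - τ/2
+ tr ad_{x_F} = χ(dF ∘ Ad_{g⁻¹}) + τ/2`.

If `χ = 0`, averaging the two expressions removes `τ` and leaves `tr D x_F = tr ad_{x_F} / 2`. The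
factor `√f₀` compensates exactly, because `d log f₀ = tr ad`.

To see that `χ = 0`, write `Φ = h ν^l`. Invariance under `X_H` becomes `χ(dH) = τ/2 - h⁻¹ dh(x_H)`.
The right side is bilinear in `π` and `dH`, which both vanish at `e`, so its derivative at `e` is
zero. Thus `χ` kills every `Hess H(ξ, ·)`, and by nondegeneracy these exhaust `𝔤*`
(`modChar_leftDeriv_leftDeriv`, `modChar_eq_zero`). -/

namespace PoissonLie

noncomputable section

open Filter Topology

/-! ### Calculus in left-translated charts -/

section Calculus

variable {E : Type*} [NormedAddCommGroup E] [NormedSpace ℝ E]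
  {G : Type*} [TopologicalSpace G] [ChartedSpace E G] [Group G]
  {W : Type*} [NormedAddCommGroup W] [NormedSpace ℝ W]

variable (E G) in
/-- The image of the identity in the preferred chart at the identity. -/
def origin : E := extChartAt 𝓘(ℝ, E) (1 : G) 1

variable (G) in
/-- The inverse of the preferred chart at the identity. -/
def param (v : E) : G := (extChartAt 𝓘(ℝ, E) (1 : G)).symm v

variable (E) in
/-- The preferred chart at the identity. -/
def coord (g : G) : E := extChartAt 𝓘(ℝ, E) (1 : G) g

@[simp]
theorem param_origin : param G (origin E G) = 1 := extChartAt_to_inv (I := 𝓘(ℝ, E)) (1 : G)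

@[simp]
theorem coord_one : coord E (1 : G) = origin E G := rfl

theorem coord_param_eventually : ∀ᶠ v in 𝓝 (origin E G), coord E (param G v) = v := by
  filter_upwards [extChartAt_target_mem_nhds (I := 𝓘(ℝ, E)) (1 : G)] with v hv
  exact (extChartAt 𝓘(ℝ, E) (1 : G)).right_inv hv

theorem param_coord_eventually : ∀ᶠ g in 𝓝 (1 : G), param G (coord E g) = g := by
  filter_upwards [extChartAt_source_mem_nhds (I := 𝓘(ℝ, E)) (1 : G)] with v hv
  exact (extChartAt 𝓘(ℝ, E) (1 : G)).left_inv hv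

variable (E) in
/-- The derivative at `g`, in the trivialization by left translations, of a function on `G`. -/
def leftDeriv (u : G → W) (g : G) : E →L[ℝ] W :=
  fderiv ℝ (fun v : E => u (g * param G v)) (origin E G)

/-- `u` is differentiable at `g`, read in the chart at the identity translated by `g`. -/
def LeftDiffAt (E : Type*) [NormedAddCommGroup E] [NormedSpace ℝ E]
    {G : Type*} [TopologicalSpace G] [ChartedSpace E G] [Group G]
    {W : Type*} [NormedAddCommGroup W] [NormedSpace ℝ W] (u : G → W) (g : G) : Prop :=
  DifferentiableAt ℝ (fun v : E => u (g * param G v)) (origin E G)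

theorem LeftDiffAt.hasFDerivAt {u : G → W} {g : G} (h : LeftDiffAt E u g) :
    HasFDerivAt (fun v : E => u (g * param G v)) (leftDeriv E u g) (origin E G) :=
  DifferentiableAt.hasFDerivAt h

variable [LieGroup 𝓘(ℝ, E) ∞ G]

instance (priority := 50) isManifold_of_lieGroup : IsManifold 𝓘(ℝ, E) ∞ G := by
  have : ContMDiffMul 𝓘(ℝ, E) ∞ G := inferInstance
  exact this.toIsManifold

theorem contMDiffAt_param_of_mem {v : E} (hv : v ∈ (extChartAt 𝓘(ℝ, E) (1 : G)).target) :
    ContMDiffAt 𝓘(ℝ, E) 𝓘(ℝ, E) ∞ (param G) v :=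
  (contMDiffOn_extChartAt_symm (I := 𝓘(ℝ, E)) (n := ∞) (1 : G)).contMDiffAt
    ((isOpen_extChartAt_target (I := 𝓘(ℝ, E)) (1 : G)).mem_nhds hv)

theorem eventually_contMDiffAt_param :
    ∀ᶠ v in 𝓝 (origin E G), ContMDiffAt 𝓘(ℝ, E) 𝓘(ℝ, E) ∞ (param G) v := by
  filter_upwards [extChartAt_target_mem_nhds (I := 𝓘(ℝ, E)) (1 : G)] with v hv
  exact contMDiffAt_param_of_mem hv

theorem contMDiffAt_coord_of_mem {g : G} (hg : g ∈ (chartAt E (1 : G)).source) :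
    ContMDiffAt 𝓘(ℝ, E) 𝓘(ℝ, E) ∞ (coord E) g :=
  contMDiffAt_extChartAt' hg

theorem contMDiffAt_coord : ContMDiffAt 𝓘(ℝ, E) 𝓘(ℝ, E) ∞ (coord E) (1 : G) :=
  contMDiffAt_coord_of_mem (mem_chart_source E (1 : G))

theorem contMDiffAt_param : ContMDiffAt 𝓘(ℝ, E) 𝓘(ℝ, E) ∞ (param G) (origin E G) :=
  contMDiffAt_param_of_mem (mem_extChartAt_target (1 : G))

theorem contMDiffAt_mul_param (g : G) :
    ContMDiffAt 𝓘(ℝ, E) 𝓘(ℝ, E) ∞ (fun v : E => g * param G v) (origin E G) :=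
  contMDiffAt_const.mul contMDiffAt_param

theorem tendsto_param : Tendsto (param G) (𝓝 (origin E G)) (𝓝 1) := by
  have := (contMDiffAt_param (E := E) (G := G)).continuousAt
  rwa [ContinuousAt, param_origin] at this

theorem tendsto_mul_param (g : G) :
    Tendsto (fun v : E => g * param G v) (𝓝 (origin E G)) (𝓝 g) := by
  have := (contMDiffAt_mul_param (E := E) g).continuousAt
  rwa [ContinuousAt, param_origin, mul_one] at this

theorem contDiffAt_mul_param {u : G → W} {g : G} (hu : ContMDiffAt 𝓘(ℝ, E) 𝓘(ℝ, W) ∞ u g) :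
    ContDiffAt ℝ ∞ (fun v : E => u (g * param G v)) (origin E G) := by
  rw [← contMDiffAt_iff_contDiffAt]
  refine ContMDiffAt.comp_of_eq hu (contMDiffAt_mul_param g) ?_
  simp

theorem _root_.ContMDiffAt.leftDiffAt {u : G → W} {g : G}
    (hu : ContMDiffAt 𝓘(ℝ, E) 𝓘(ℝ, W) ∞ u g) : LeftDiffAt E u g :=
  (contDiffAt_mul_param hu).differentiableAt (by simp)

/-- Smooth dependence on parameters of the derivative at the identity. -/
theorem contMDiffAt_fderiv_param {f : G → G → W} {g : G}
    (hf : ContMDiffAt (𝓘(ℝ, E).prod 𝓘(ℝ, E)) 𝓘(ℝ, W) ∞ (Function.uncurry f) (g, 1)) :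
    ContMDiffAt 𝓘(ℝ, E) 𝓘(ℝ, E →L[ℝ] W) ∞
      (fun p => fderiv ℝ (fun v : E => f p (param G v)) (origin E G)) g := by
  have h1 : ContMDiffAt (𝓘(ℝ, E).prod 𝓘(ℝ, E)) 𝓘(ℝ, W) ∞
      (Function.uncurry fun (p : G) (v : E) => f p (param G v)) (g, origin E G) := by
    have h2 : ContMDiffAt (𝓘(ℝ, E).prod 𝓘(ℝ, E)) (𝓘(ℝ, E).prod 𝓘(ℝ, E)) ∞
        (fun q : G × E => (q.1, param G q.2)) (g, origin E G) :=
      contMDiffAt_fst.prodMk (ContMDiffAt.comp_of_eq contMDiffAt_param contMDiffAt_snd rfl)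
    exact ContMDiffAt.comp_of_eq hf h2 (by simp)
  have h3 := ContMDiffAt.mfderiv (m := ∞) (fun (p : G) (v : E) => f p (param G v))
    (fun _ => origin E G) h1 contMDiffAt_const (by simp)
  refine h3.congr_of_eventuallyEq (Eventually.of_forall fun p => ?_)
  have h4 := congrFun (inTangentCoordinates_model_space (I := 𝓘(ℝ, E)) (I' := 𝓘(ℝ, W))
    (fun _ : G => origin E G) (fun p => f p (param G (origin E G)))
    (fun p => mfderiv 𝓘(ℝ, E) 𝓘(ℝ, W) (fun v : E => f p (param G v)) (origin E G)) g) p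
  exact (h4.trans (mfderiv_eq_fderiv (f := fun v : E => f p (param G v)))).symm

theorem contMDiffAt_leftDeriv {u : G → W} {g : G}
    (hu : ContMDiffAt 𝓘(ℝ, E) 𝓘(ℝ, W) ∞ u g) :
    ContMDiffAt 𝓘(ℝ, E) 𝓘(ℝ, E →L[ℝ] W) ∞ (leftDeriv E u) g := by
  refine contMDiffAt_fderiv_param (f := fun p h => u (p * h)) ?_
  refine ContMDiffAt.comp_of_eq (I' := 𝓘(ℝ, E)) (f := fun q : G × G => q.1 * q.2) hu
    (contMDiffAt_fst.mul contMDiffAt_snd) ?_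
  simp

end Calculus

/-! ### Manifold derivatives as maps of model spaces -/

section Differential

variable {E : Type*} [NormedAddCommGroup E] [NormedSpace ℝ E]
  {E' : Type*} [NormedAddCommGroup E'] [NormedSpace ℝ E']
  {E'' : Type*} [NormedAddCommGroup E''] [NormedSpace ℝ E'']
  {M : Type*} [TopologicalSpace M] [ChartedSpace E M]
  {M' : Type*} [TopologicalSpace M'] [ChartedSpace E' M']
  {M'' : Type*} [TopologicalSpace M''] [ChartedSpace E'' M'']

variable (E E') in
/-- The manifold derivative, as a map between the model spaces. -/
def mder (f : M → M') (x : M) : E →L[ℝ] E' := mfderiv 𝓘(ℝ, E) 𝓘(ℝ, E') f x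

theorem mder_comp {f : M → M'} {k : M' → M''} {x : M} {y : M'} (hy : f x = y)
    (hk : MDifferentiableAt 𝓘(ℝ, E') 𝓘(ℝ, E'') k y)
    (hf : MDifferentiableAt 𝓘(ℝ, E) 𝓘(ℝ, E') f x) :
    mder E E'' (fun z => k (f z)) x = (mder E' E'' k y).comp (mder E E' f x) := by
  subst hy
  exact mfderiv_comp x hk hf

theorem mder_congr {f k : M → M'} {x : M} (h : f =ᶠ[𝓝 x] k) : mder E E' f x = mder E E' k x :=
  h.mfderiv_eq

theorem mder_id (x : M) : mder E E (fun z : M => z) x = ContinuousLinearMap.id ℝ E :=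
  mfderiv_id

theorem mder_eq_fderiv (f : E → E') (x : E) : mder E E' f x = fderiv ℝ f x :=
  mfderiv_eq_fderiv

end Differential

/-! ### Translations and the left trivialization -/

section Translation

variable {E : Type*} [NormedAddCommGroup E] [NormedSpace ℝ E]
  {G : Type*} [TopologicalSpace G] [ChartedSpace E G] [Group G]
  {W : Type*} [NormedAddCommGroup W] [NormedSpace ℝ W]

variable (E) in
/-- The differential at the identity of the left translation by `g`. -/
def leftTrans (g : G) : E →L[ℝ] E := mder E E (fun x : G => g * x) 1

variable (E) in
/-- The differential at `g` of the left translation by `g⁻¹`. -/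
def leftTransInv (g : G) : E →L[ℝ] E := mder E E (fun x : G => g⁻¹ * x) g

variable (E) in
/-- The adjoint action, as an endomorphism of the model space. -/
def adj (g : G) : E →L[ℝ] E := mder E E (fun x : G => g * x * g⁻¹) 1

variable [LieGroup 𝓘(ℝ, E) ∞ G]

theorem mdifferentiableAt_mul_left (g h : G) :
    MDifferentiableAt 𝓘(ℝ, E) 𝓘(ℝ, E) (fun x : G => g * x) h :=
  (contMDiff_mul_left (I := 𝓘(ℝ, E)) (n := ∞) (a := g)).mdifferentiable (by simp) h

theorem mdifferentiableAt_mul_right (g h : G) :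
    MDifferentiableAt 𝓘(ℝ, E) 𝓘(ℝ, E) (fun x : G => x * g) h :=
  (contMDiff_mul_right (I := 𝓘(ℝ, E)) (n := ∞) (a := g)).mdifferentiable (by simp) h

theorem contMDiff_conj (g : G) :
    ContMDiff 𝓘(ℝ, E) 𝓘(ℝ, E) ∞ (fun x : G => g * x * g⁻¹) :=
  (contMDiff_const.mul contMDiff_id).mul contMDiff_const

theorem mdifferentiableAt_conj (g h : G) :
    MDifferentiableAt 𝓘(ℝ, E) 𝓘(ℝ, E) (fun x : G => g * x * g⁻¹) h :=
  (contMDiff_conj g).mdifferentiable (by simp) h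

theorem mdifferentiableAt_param :
    MDifferentiableAt 𝓘(ℝ, E) 𝓘(ℝ, E) (param G) (origin E G) :=
  contMDiffAt_param.mdifferentiableAt (by simp)

theorem mdifferentiableAt_coord :
    MDifferentiableAt 𝓘(ℝ, E) 𝓘(ℝ, E) (coord E) (1 : G) :=
  contMDiffAt_coord.mdifferentiableAt (by simp)

theorem mder_param : mder E E (param G) (origin E G) = ContinuousLinearMap.id ℝ E := by
  have : IsManifold 𝓘(ℝ, E) 1 G := (isManifold_of_lieGroup (E := E) (G := G)).of_le (by simp)
  have h := mfderivWithin_range_extChartAt_symm (I := 𝓘(ℝ, E)) (x := (1 : G))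
  rw [ModelWithCorners.range_eq_univ, mfderivWithin_univ] at h
  exact h

theorem mder_coord : mder E E (coord E) (1 : G) = ContinuousLinearMap.id ℝ E := by
  have : IsManifold 𝓘(ℝ, E) 1 G := (isManifold_of_lieGroup (E := E) (G := G)).of_le (by simp)
  exact mfderiv_extChartAt_self (I := 𝓘(ℝ, E)) (x := (1 : G))

theorem leftTransInv_comp_leftTrans (g : G) :
    (leftTransInv E g).comp (leftTrans E g) = ContinuousLinearMap.id ℝ E := by
  rw [leftTransInv, leftTrans, ← mder_comp (mul_one g) (mdifferentiableAt_mul_left _ _)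
    (mdifferentiableAt_mul_left _ _)]
  simpa using mder_id (E := E) (1 : G)

theorem leftTrans_comp_leftTransInv (g : G) :
    (leftTrans E g).comp (leftTransInv E g) = ContinuousLinearMap.id ℝ E := by
  rw [leftTransInv, leftTrans, ← mder_comp (inv_mul_cancel g) (mdifferentiableAt_mul_left _ _)
    (mdifferentiableAt_mul_left _ _)]
  simpa using mder_id (E := E) g

@[simp]
theorem leftTransInv_leftTrans (g : G) (ξ : E) : leftTransInv E g (leftTrans E g ξ) = ξ :=
  DFunLike.congr_fun (leftTransInv_comp_leftTrans g) ξ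

@[simp]
theorem leftTrans_leftTransInv (g : G) (ξ : E) : leftTrans E g (leftTransInv E g ξ) = ξ :=
  DFunLike.congr_fun (leftTrans_comp_leftTransInv g) ξ

theorem mder_comp_leftTrans {u : G → W} {g : G} (hu : MDifferentiableAt 𝓘(ℝ, E) 𝓘(ℝ, W) u g) :
    (mder E W u g).comp (leftTrans E g) = leftDeriv E u g := by
  rw [leftDeriv, ← mder_eq_fderiv, mder_comp (k := u) (y := g) (by simp) hu
    ((contMDiffAt_mul_param g).mdifferentiableAt (by simp)),
    mder_comp (k := fun x => g * x) (y := 1) (by simp) (mdifferentiableAt_mul_left _ _)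
      mdifferentiableAt_param, mder_param, ContinuousLinearMap.comp_id, leftTrans]

theorem mder_eq_leftDeriv_comp {u : G → W} {g : G}
    (hu : MDifferentiableAt 𝓘(ℝ, E) 𝓘(ℝ, W) u g) :
    mder E W u g = (leftDeriv E u g).comp (leftTransInv E g) := by
  rw [← mder_comp_leftTrans hu, ContinuousLinearMap.comp_assoc, leftTrans_comp_leftTransInv,
    ContinuousLinearMap.comp_id]

/-- Near `g` the map `x ↦ coord (g⁻¹ x)` inverts `v ↦ g * param v`, so `u` factors through the
translated chart. -/
theorem LeftDiffAt.mdifferentiableAt {u : G → W} {g : G} (h : LeftDiffAt E u g) :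
    MDifferentiableAt 𝓘(ℝ, E) 𝓘(ℝ, W) u g := by
  have h1 : MDifferentiableAt 𝓘(ℝ, E) 𝓘(ℝ, E) (fun x : G => coord E (g⁻¹ * x)) g :=
    MDifferentiableAt.comp_of_eq g mdifferentiableAt_coord (mdifferentiableAt_mul_left g⁻¹ g)
      (inv_mul_cancel g)
  have h2 : MDifferentiableAt 𝓘(ℝ, E) 𝓘(ℝ, W)
      (fun x : G => u (g * param G (coord E (g⁻¹ * x)))) g :=
    MDifferentiableAt.comp_of_eq g (I' := 𝓘(ℝ, E)) (g := fun v : E => u (g * param G v))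
      (DifferentiableAt.mdifferentiableAt h) h1 (by simp)
  refine h2.congr_of_eventuallyEq ?_
  have h3 : Tendsto (fun x : G => g⁻¹ * x) (𝓝 g) (𝓝 1) := by
    have := (mdifferentiableAt_mul_left (E := E) g⁻¹ g).continuousAt
    rwa [ContinuousAt, inv_mul_cancel] at this
  filter_upwards [h3.eventually (param_coord_eventually (E := E))] with x hx
  rw [hx, mul_inv_cancel_left]

theorem leftDeriv_one {u : G → W} (h : LeftDiffAt E u 1) :
    mder E W u 1 = leftDeriv E u (1 : G) := by
  rw [mder_eq_leftDeriv_comp h.mdifferentiableAt]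
  have : leftTransInv E (1 : G) = ContinuousLinearMap.id ℝ E := by
    simpa [leftTransInv] using mder_id (E := E) (1 : G)
  rw [this, ContinuousLinearMap.comp_id]

theorem leftDeriv_coord : leftDeriv E (coord E) (1 : G) = ContinuousLinearMap.id ℝ E := by
  rw [← leftDeriv_one contMDiffAt_coord.leftDiffAt, mder_coord]

end Translation

/-! ### Second derivatives, the Lie bracket and the adjoint representation -/

section Bracket

variable {E : Type*} [NormedAddCommGroup E] [NormedSpace ℝ E]
  {G : Type*} [TopologicalSpace G] [ChartedSpace E G] [Group G] [LieGroup 𝓘(ℝ, E) ∞ G]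
  {W : Type*} [NormedAddCommGroup W] [NormedSpace ℝ W]

/-- Moving the base point from `g` to `g * param x` changes the translated chart; the transition map
is `y ↦ coord (param x * param y)`, whose derivative is the extra factor. -/
theorem leftDeriv_mul_param_eventually {u : G → W} {g : G}
    (hu : ContMDiffAt 𝓘(ℝ, E) 𝓘(ℝ, W) ∞ u g) :
    ∀ᶠ x in 𝓝 (origin E G), leftDeriv E u (g * param G x) =
      (fderiv ℝ (fun v : E => u (g * param G v)) x).comp
        (leftDeriv E (coord E) (param G x)) := by
  have h1 : ∀ᶠ x in 𝓝 (origin E G), ContDiffAt ℝ 1 (fun v : E => u (g * param G v)) x :=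
    ((contDiffAt_mul_param hu).of_le (by simp)).eventually (by simp)
  have h2 : ∀ᶠ x in 𝓝 (origin E G), param G x ∈ (chartAt E (1 : G)).source :=
    tendsto_param ((chartAt E (1 : G)).open_source.mem_nhds (mem_chart_source E (1 : G)))
  filter_upwards [h1, h2, coord_param_eventually (E := E) (G := G)] with x hx1 hx2 hx3
  have h3 : HasFDerivAt (fun y : E => coord E (param G x * param G y))
      (leftDeriv E (coord E) (param G x)) (origin E G) :=
    (contMDiffAt_coord_of_mem hx2).leftDiffAt.hasFDerivAt
  have h4 : HasFDerivAt (fun v : E => u (g * param G v))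
      (fderiv ℝ (fun v : E => u (g * param G v)) x)
      (coord E (param G x * param G (origin E G))) := by
    rw [param_origin, mul_one, hx3]
    exact (hx1.differentiableAt (by simp)).hasFDerivAt
  have h5 := h4.comp (origin E G) h3
  refine (h5.congr_of_eventuallyEq ?_).fderiv
  have h6 : ∀ᶠ y in 𝓝 (origin E G), param G x * param G y ∈ (chartAt E (1 : G)).source :=
    tendsto_mul_param (param G x) ((chartAt E (1 : G)).open_source.mem_nhds hx2)
  filter_upwards [h6] with y hy
  have h7 : param G (coord E (param G x * param G y)) = param G x * param G y :=
    (extChartAt 𝓘(ℝ, E) (1 : G)).left_inv (by rwa [extChartAt_source])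
  simp only [Function.comp_apply]
  rw [h7, mul_assoc]

variable (E G) in
/-- The mixed second derivative at the identity of the group law, read in the chart at the
identity. -/
def mulSecond : E →L[ℝ] E →L[ℝ] E := leftDeriv E (leftDeriv E (coord E)) (1 : G)

variable (E G) in
/-- The Lie bracket of the Lie algebra, on the model space. -/
def lieBr : E →L[ℝ] E →L[ℝ] E := mulSecond E G - (mulSecond E G).flip

theorem lieBr_apply (ξ η : E) : lieBr E G ξ η = mulSecond E G ξ η - mulSecond E G η ξ := rfl

theorem lieBr_swap (ξ η : E) : lieBr E G ξ η = - lieBr E G η ξ := by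
  simp [lieBr_apply]

theorem hasFDerivAt_leftDeriv_coord :
    HasFDerivAt (fun v : E => leftDeriv E (coord E) (param G v)) (mulSecond E G)
      (origin E G) := by
  have := (contMDiffAt_leftDeriv (contMDiffAt_coord (E := E) (G := G))).leftDiffAt.hasFDerivAt
  simp only [one_mul] at this
  exact this

/-- The chart Hessian is symmetric; the correction comes from differentiating the transition factor.
It is therefore the only source of asymmetry, and antisymmetrizing leaves the Lie bracket. -/
theorem leftDeriv_leftDeriv {u : G → W} {g : G} (hu : ContMDiffAt 𝓘(ℝ, E) 𝓘(ℝ, W) ∞ u g)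
    (ξ η : E) :
    leftDeriv E (leftDeriv E u) g ξ η =
      fderiv ℝ (fderiv ℝ (fun v : E => u (g * param G v))) (origin E G) ξ η +
        leftDeriv E u g (mulSecond E G ξ η) := by
  have h1 : DifferentiableAt ℝ (fderiv ℝ (fun v : E => u (g * param G v))) (origin E G) :=
    ((contDiffAt_mul_param hu).fderiv_right (m := ∞) (by simp)).differentiableAt (by simp)
  have h2 := h1.hasFDerivAt.clm_comp (hasFDerivAt_leftDeriv_coord (E := E) (G := G))
  have h3 := (h2.congr_of_eventuallyEq (leftDeriv_mul_param_eventually hu)).fderiv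
  have h4 := congrArg (fun T : E →L[ℝ] E →L[ℝ] W => T ξ η) h3
  refine h4.trans ?_
  simp only [param_origin, leftDeriv_coord]
  simp [add_comm]
  rfl

theorem leftDeriv_leftDeriv_sub {u : G → W} {g : G}
    (hu : ContMDiffAt 𝓘(ℝ, E) 𝓘(ℝ, W) ∞ u g) (ξ η : E) :
    leftDeriv E (leftDeriv E u) g ξ η - leftDeriv E (leftDeriv E u) g η ξ =
      leftDeriv E u g (lieBr E G ξ η) := by
  have h : IsSymmSndFDerivAt ℝ (fun v : E => u (g * param G v)) (origin E G) :=
    (contDiffAt_mul_param hu).isSymmSndFDerivAt (by simp; norm_cast)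
  rw [leftDeriv_leftDeriv hu, leftDeriv_leftDeriv hu, h.eq η ξ, lieBr_apply, map_sub]
  abel

theorem fderiv_conj {u : G → W} (hu : LeftDiffAt E u 1) (g : G) :
    HasFDerivAt (fun v : E => u (g * param G v * g⁻¹)) ((leftDeriv E u 1).comp (adj E g))
      (origin E G) := by
  have h1 : MDifferentiableAt 𝓘(ℝ, E) 𝓘(ℝ, E) (fun v : E => g * param G v * g⁻¹)
      (origin E G) :=
    MDifferentiableAt.comp_of_eq (origin E G) (mdifferentiableAt_conj g 1)
      mdifferentiableAt_param (by simp)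
  have h2 : MDifferentiableAt 𝓘(ℝ, E) 𝓘(ℝ, W) (fun v : E => u (g * param G v * g⁻¹))
      (origin E G) :=
    MDifferentiableAt.comp_of_eq (origin E G) hu.mdifferentiableAt h1 (by simp)
  have h3 : fderiv ℝ (fun v : E => u (g * param G v * g⁻¹)) (origin E G) =
      (leftDeriv E u 1).comp (adj E g) := by
    rw [← mder_eq_fderiv, mder_comp (k := u) (y := 1) (by simp) hu.mdifferentiableAt h1,
      mder_comp (k := fun x => g * x * g⁻¹) (y := 1) (by simp) (mdifferentiableAt_conj _ _)
        mdifferentiableAt_param, mder_param, ContinuousLinearMap.comp_id, leftDeriv_one hu, adj]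
  rw [← h3]
  exact h2.differentiableAt.hasFDerivAt

theorem adj_eq_fderiv (g : G) :
    adj E g = fderiv ℝ (fun v : E => coord E (g * param G v * g⁻¹)) (origin E G) := by
  rw [(fderiv_conj contMDiffAt_coord.leftDiffAt g).fderiv, leftDeriv_coord,
    ContinuousLinearMap.id_comp]

theorem contMDiffAt_adj (g : G) : ContMDiffAt 𝓘(ℝ, E) 𝓘(ℝ, E →L[ℝ] E) ∞ (adj E) g := by
  have h : ContMDiffAt (𝓘(ℝ, E).prod 𝓘(ℝ, E)) 𝓘(ℝ, E) ∞
      (Function.uncurry fun p h : G => coord E (p * h * p⁻¹)) (g, 1) := by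
    refine ContMDiffAt.comp_of_eq (I' := 𝓘(ℝ, E)) (f := fun q : G × G => q.1 * q.2 * q.1⁻¹)
      contMDiffAt_coord ((contMDiffAt_fst.mul contMDiffAt_snd).mul contMDiffAt_fst.inv) ?_
    simp
  exact (contMDiffAt_fderiv_param h).congr_of_eventuallyEq
    (Eventually.of_forall fun p => adj_eq_fderiv p)

theorem adj_one : adj E (1 : G) = ContinuousLinearMap.id ℝ E := by
  simpa [adj] using mder_id (E := E) (1 : G)

theorem adj_mul (g h : G) : adj E (g * h) = (adj E g).comp (adj E h) := by
  rw [adj, adj, adj, ← mder_comp (by simp) (mdifferentiableAt_conj _ _)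
    (mdifferentiableAt_conj _ _)]
  simp [mul_assoc]

theorem adj_comp_adj_inv (g : G) :
    (adj E g).comp (adj E g⁻¹) = ContinuousLinearMap.id ℝ E := by
  rw [← adj_mul, mul_inv_cancel, adj_one]

theorem adj_inv_comp_adj (g : G) :
    (adj E g⁻¹).comp (adj E g) = ContinuousLinearMap.id ℝ E := by
  rw [← adj_mul, inv_mul_cancel, adj_one]

/-- Differentiating the group law in its first factor, then in the second, is the same mixed
derivative as `mulSecond` taken in the opposite order; symmetry of the second derivative gives the
flip. -/
theorem hasFDerivAt_coord_mul_right :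
    HasFDerivAt (fun x : E => fderiv ℝ (fun y : E => coord E (param G y * param G x))
      (origin E G)) (mulSecond E G).flip (origin E G) := by
  set o := origin E G
  let f : E × E → E := fun p => coord E (param G p.1 * param G p.2)
  have hf : ContDiffAt ℝ ∞ f (o, o) := by
    rw [← contMDiffAt_iff_contDiffAt]
    have h1 : ContMDiffAt 𝓘(ℝ, E × E) 𝓘(ℝ, E) ∞ (fun p : E × E => param G p.1) (o, o) :=
      ContMDiffAt.comp_of_eq contMDiffAt_param contDiffAt_fst.contMDiffAt rfl
    have h2 : ContMDiffAt 𝓘(ℝ, E × E) 𝓘(ℝ, E) ∞ (fun p : E × E => param G p.2) (o, o) :=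
      ContMDiffAt.comp_of_eq contMDiffAt_param contDiffAt_snd.contMDiffAt rfl
    exact ContMDiffAt.comp_of_eq contMDiffAt_coord (h1.mul h2) (by simp [o])
  have hfe : ∀ᶠ p in 𝓝 (o, o), DifferentiableAt ℝ f p := by
    filter_upwards [(hf.of_le (m := 1) (by simp)).eventually (by simp)] with p hp
    exact hp.differentiableAt (by simp)
  have hD : HasFDerivAt (fderiv ℝ f) (fderiv ℝ (fderiv ℝ f) (o, o)) (o, o) :=
    ((hf.fderiv_right (m := ∞) (by simp)).differentiableAt (by simp)).hasFDerivAt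
  have hs : IsSymmSndFDerivAt ℝ f (o, o) := hf.isSymmSndFDerivAt (by simp; norm_cast)
  have c1 : HasFDerivAt (fun x : E => (x, o)) (ContinuousLinearMap.inl ℝ E E) o :=
    hasFDerivAt_prodMk_left o o
  have c2 : HasFDerivAt (fun x : E => (o, x)) (ContinuousLinearMap.inr ℝ E E) o :=
    hasFDerivAt_prodMk_right o o
  have hN : ∀ᶠ x in 𝓝 o, leftDeriv E (coord E) (param G x) =
      (fderiv ℝ f (x, o)).comp (ContinuousLinearMap.inr ℝ E E) := by
    filter_upwards [c1.continuousAt.eventually hfe] with x hx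
    exact (HasFDerivAt.comp (f := fun y : E => (x, y)) o hx.hasFDerivAt
      (hasFDerivAt_prodMk_right x o)).fderiv
  have hR : ∀ᶠ x in 𝓝 o, fderiv ℝ (fun y : E => coord E (param G y * param G x)) o =
      (fderiv ℝ f (o, x)).comp (ContinuousLinearMap.inl ℝ E E) := by
    filter_upwards [c2.continuousAt.eventually hfe] with x hx
    exact (HasFDerivAt.comp (f := fun y : E => (y, x)) o hx.hasFDerivAt
      (hasFDerivAt_prodMk_left o x)).fderiv
  have dN := (((HasFDerivAt.comp (f := fun x : E => (x, o)) o hD c1).clm_comp (hasFDerivAt_const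
    (ContinuousLinearMap.inr ℝ E E) o)).congr_of_eventuallyEq hN).unique
    hasFDerivAt_leftDeriv_coord
  have dR := ((HasFDerivAt.comp (f := fun x : E => (o, x)) o hD c2).clm_comp (hasFDerivAt_const
    (ContinuousLinearMap.inl ℝ E E) o)).congr_of_eventuallyEq hR
  convert dR using 1
  rw [← dN]
  ext ξ η
  simpa using hs.eq (η, 0) (0, ξ)

/-- From `x y = (x y x⁻¹) x`, the derivative of the product in `y` is its derivative in the first
factor composed with `Ad_x`. Differentiating in `x` at the identity gives `mulSecond =
mulSecond.flip + D Ad`. -/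
theorem leftDeriv_adj_one : leftDeriv E (adj E) (1 : G) = lieBr E G := by
  have h1 := (contMDiffAt_adj (E := E) (1 : G)).leftDiffAt.hasFDerivAt
  simp only [one_mul] at h1
  have h2 := (hasFDerivAt_coord_mul_right (E := E) (G := G)).clm_comp h1
  have h3 : ∀ᶠ x in 𝓝 (origin E G), leftDeriv E (coord E) (param G x) =
      (fderiv ℝ (fun y : E => coord E (param G y * param G x)) (origin E G)).comp
        (adj E (param G x)) := by
    have h2 : ∀ᶠ x in 𝓝 (origin E G), param G x ∈ (chartAt E (1 : G)).source :=
      tendsto_param ((chartAt E (1 : G)).open_source.mem_nhds (mem_chart_source E (1 : G)))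
    filter_upwards [h2] with x hx
    have h4 : ContMDiffAt 𝓘(ℝ, E) 𝓘(ℝ, E) ∞ (fun k : G => coord E (k * param G x)) 1 :=
      ContMDiffAt.comp_of_eq (contMDiffAt_coord_of_mem hx) contMDiffAt_mul_right (by simp)
    have h5 := (fderiv_conj h4.leftDiffAt (param G x)).fderiv
    simpa [leftDeriv] using h5
  have h4 := (h2.congr_of_eventuallyEq h3).unique hasFDerivAt_leftDeriv_coord
  have h5 : fderiv ℝ (fun y : E => coord E (param G y)) (origin E G) =
      ContinuousLinearMap.id ℝ E := by
    simpa [leftDeriv] using leftDeriv_coord (E := E) (G := G)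
  ext ξ η
  have h6 := congrArg (fun T : E →L[ℝ] E →L[ℝ] E => T ξ η) h4
  simp only [param_origin, mul_one, adj_one, h5] at h6
  simp at h6
  rw [lieBr_apply, ← h6]
  abel

end Bracket

/-! ### Vector fields and their brackets in the left trivialization -/

section VectorFields

variable {E : Type*} [NormedAddCommGroup E] [NormedSpace ℝ E]
  {G : Type*} [TopologicalSpace G] [ChartedSpace E G] [Group G] [LieGroup 𝓘(ℝ, E) ∞ G]

/-- A vector field on `G`, read in the trivialization by left translations. -/
def triv (X : ∀ g : G, Tan E g) (g : G) : E := leftTransInv E g (X g)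

theorem mder_apply_eq {W : Type*} [NormedAddCommGroup W] [NormedSpace ℝ W] {u : G → W} {g : G}
    (hu : LeftDiffAt E u g) (X : ∀ g : G, Tan E g) :
    mder E W u g (X g) = leftDeriv E u g (triv X g) := by
  rw [mder_eq_leftDeriv_comp hu.mdifferentiableAt]
  rfl

theorem trivializationAt_eventually (X : ∀ g : G, Tan E g) (g₀ : G) :
    ∀ᶠ g in 𝓝 g₀, (trivializationAt E (TangentSpace 𝓘(ℝ, E)) g₀
      (⟨g, X g⟩ : TangentBundle 𝓘(ℝ, E) G)).2 =
        leftDeriv E (extChartAt 𝓘(ℝ, E) g₀) g (triv X g) := by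
  filter_upwards [(chartAt E g₀).open_source.mem_nhds (mem_chart_source E g₀)] with g hg
  have h1 := TangentBundle.continuousLinearMapAt_trivializationAt (I := 𝓘(ℝ, E)) hg
  have h2 : (trivializationAt E (TangentSpace 𝓘(ℝ, E)) g₀).continuousLinearMapAt ℝ g (X g) =
      mder E E (extChartAt 𝓘(ℝ, E) g₀) g (X g) := by rw [h1]; rfl
  have h3 := Bundle.Trivialization.continuousLinearMapAt_apply_of_mem (R := ℝ)
    (trivializationAt E (TangentSpace 𝓘(ℝ, E)) g₀) (b := g) (by simpa using hg) (X g)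
  refine h3.symm.trans (h2.trans ?_)
  exact mder_apply_eq (ContMDiffAt.leftDiffAt (contMDiffAt_extChartAt' hg)) X

theorem mdifferentiableAt_of_leftDiffAt {X : ∀ g : G, Tan E g} {g : G}
    (hX : LeftDiffAt E (triv X) g) :
    MDifferentiableAt 𝓘(ℝ, E) 𝓘(ℝ, E).tangent
      (fun x => (⟨x, X x⟩ : TangentBundle 𝓘(ℝ, E) G)) g := by
  refine (mdifferentiableAt_section 𝓘(ℝ, E) (F := E) X).2 ?_
  have h1 : MDifferentiableAt 𝓘(ℝ, E) 𝓘(ℝ, E)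
      (fun k => leftDeriv E (extChartAt 𝓘(ℝ, E) g) k (triv X k)) g :=
    ((contMDiffAt_leftDeriv contMDiffAt_extChartAt).mdifferentiableAt (by simp)).clm_apply
      hX.mdifferentiableAt
  exact h1.congr_of_eventuallyEq (trivializationAt_eventually X g)

theorem isSmoothVectorField_of_triv {X : ∀ g : G, Tan E g}
    (hX : ContMDiff 𝓘(ℝ, E) 𝓘(ℝ, E) ∞ (triv X)) : IsSmoothVectorField X := by
  intro g
  refine (Bundle.contMDiffAt_section (F := E) (IB := 𝓘(ℝ, E)) g).2 ?_
  have h1 : ContMDiffAt 𝓘(ℝ, E) 𝓘(ℝ, E) ∞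
      (fun k => leftDeriv E (extChartAt 𝓘(ℝ, E) g) k (triv X k)) g :=
    (contMDiffAt_leftDeriv contMDiffAt_extChartAt).clm_apply (hX g)
  exact h1.congr_of_eventuallyEq (trivializationAt_eventually X g)

theorem isInvertible_leftDeriv_extChartAt (g : G) :
    (leftDeriv E (extChartAt 𝓘(ℝ, E) g) g).IsInvertible := by
  have h : mder E E (extChartAt 𝓘(ℝ, E) g) g = ContinuousLinearMap.id ℝ E :=
    mfderiv_extChartAt_self (I := 𝓘(ℝ, E)) (x := g)
  rw [← mder_comp_leftTrans (ContMDiffAt.leftDiffAt contMDiffAt_extChartAt).mdifferentiableAt, h,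
    ContinuousLinearMap.id_comp]
  exact .of_inverse (leftTrans_comp_leftTransInv g) (leftTransInv_comp_leftTrans g)

theorem _root_.ContDiffAt.contMDiffAt_comp {F F' : Type*} [NormedAddCommGroup F] [NormedSpace ℝ F]
    [NormedAddCommGroup F'] [NormedSpace ℝ F'] {k : F → F'} {u : G → F} {g : G}
    (hk : ContDiffAt ℝ ∞ k (u g)) (hu : ContMDiffAt 𝓘(ℝ, E) 𝓘(ℝ, F) ∞ u g) :
    ContMDiffAt 𝓘(ℝ, E) 𝓘(ℝ, F') ∞ (fun x => k (u x)) g :=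
  ContMDiffAt.comp g hk.contMDiffAt hu

variable [FiniteDimensional ℝ E]

/-- The bundle coordinates of `X` are `A(k) (triv X k)` with `A` smooth and invertible at `g`, hence
invertible nearby, with smooth inverse. -/
theorem contMDiff_triv {X : ∀ g : G, Tan E g} (hX : IsSmoothVectorField X) :
    ContMDiff 𝓘(ℝ, E) 𝓘(ℝ, E) ∞ (triv X) := by
  intro g
  have : CompleteSpace E := FiniteDimensional.complete ℝ E
  have h1 := (Bundle.contMDiffAt_section (F := E) (IB := 𝓘(ℝ, E)) g).1 (hX g)
  have hA := contMDiffAt_leftDeriv (E := E) (contMDiffAt_extChartAt (I := 𝓘(ℝ, E)) (n := ∞)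
    (x := g))
  have hi := isInvertible_leftDeriv_extChartAt (E := E) g
  have h2 : ContMDiffAt 𝓘(ℝ, E) 𝓘(ℝ, E →L[ℝ] E) ∞
      (fun k => (leftDeriv E (extChartAt 𝓘(ℝ, E) g) k).inverse) g :=
    ContDiffAt.contMDiffAt_comp hi.contDiffAt_map_inverse hA
  refine (h2.clm_apply h1).congr_of_eventuallyEq ?_
  obtain ⟨e, he⟩ := hi
  have h3 : ∀ᶠ k in 𝓝 g, ∃ e : E ≃L[ℝ] E, (e : E →L[ℝ] E) =
      leftDeriv E (extChartAt 𝓘(ℝ, E) g) k := by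
    have := hA.continuousAt
    rw [ContinuousAt, ← he] at this
    exact this (ContinuousLinearEquiv.nhds e)
  filter_upwards [trivializationAt_eventually X g, h3] with k hk ⟨e', he'⟩
  rw [hk, ← he']
  simp

/-- With `T` the derivative of `v ↦ g * param v` and `N` the transition factor, `T ∘ N` is the
differential of left translation, so `T⁻¹ X = N (triv X)`. The neighbourhood is independent of `X`.
-/
theorem mpullback_mul_param_eventually (g : G) :
    ∀ᶠ v in 𝓝 (origin E G), ∀ X : ∀ g : G, Tan E g,
      VectorField.mpullback 𝓘(ℝ, E) 𝓘(ℝ, E) (fun v : E => g * param G v) X v =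
        leftDeriv E (coord E) (param G v) (triv X (g * param G v)) := by
  have h2 : ∀ᶠ x in 𝓝 (origin E G), param G x ∈ (chartAt E (1 : G)).source :=
    tendsto_param ((chartAt E (1 : G)).open_source.mem_nhds (mem_chart_source E (1 : G)))
  filter_upwards [h2, coord_param_eventually (E := E) (G := G),
    eventually_contMDiffAt_param (E := E) (G := G)] with v hv1 hv2 hv3 X
  have hψ : MDifferentiableAt 𝓘(ℝ, E) 𝓘(ℝ, E) (fun v : E => g * param G v) v :=
    ContMDiffAt.mdifferentiableAt (contMDiffAt_const.mul hv3) (n := ∞) (by simp)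
  have hc : DifferentiableAt ℝ (fun y : E => coord E (param G v * param G y)) (origin E G) :=
    (contMDiffAt_coord_of_mem hv1).leftDiffAt
  have h3 : (mder E E (fun v : E => g * param G v) v).comp (leftDeriv E (coord E) (param G v)) =
      leftTrans E (g * param G v) := by
    rw [leftDeriv, ← mder_eq_fderiv, ← mder_comp (by simp [hv2]) hψ hc.mdifferentiableAt]
    have h4 : (fun y : E => g * param G (coord E (param G v * param G y)))
        =ᶠ[𝓝 (origin E G)] fun y => (g * param G v) * param G y := by
      have h6 : ∀ᶠ y in 𝓝 (origin E G), param G v * param G y ∈ (chartAt E (1 : G)).source :=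
        tendsto_mul_param (param G v) ((chartAt E (1 : G)).open_source.mem_nhds hv1)
      filter_upwards [h6] with y hy
      have h7 : param G (coord E (param G v * param G y)) = param G v * param G y :=
        (extChartAt 𝓘(ℝ, E) (1 : G)).left_inv (by rwa [extChartAt_source])
      rw [h7, mul_assoc]
    rw [mder_congr h4, mder_comp (k := fun x => g * param G v * x) (y := 1) (by simp)
      (mdifferentiableAt_mul_left _ _) mdifferentiableAt_param, mder_param,
      ContinuousLinearMap.comp_id, leftTrans]
  set T := mder E E (fun v : E => g * param G v) v
  set N := leftDeriv E (coord E) (param G v)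
  have h4 : T.comp (N.comp (leftTransInv E (g * param G v))) = ContinuousLinearMap.id ℝ E := by
    rw [← ContinuousLinearMap.comp_assoc, h3, leftTrans_comp_leftTransInv]
  -- In finite dimension a right inverse of an endomorphism is also a left inverse.
  have h5 : (N.comp (leftTransInv E (g * param G v))).comp T = ContinuousLinearMap.id ℝ E := by
    have h6 : T.toLinearMap * (N.comp (leftTransInv E (g * param G v))).toLinearMap = 1 := by
      ext x
      exact DFunLike.congr_fun h4 x
    have h7 := mul_eq_one_comm.1 h6
    ext x
    exact DFunLike.congr_fun h7 x
  have h6 := ContinuousLinearMap.inverse_eq h4 h5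
  exact DFunLike.congr_fun h6 (X (g * param G v))

/-- The bracket commutes with pullback to `E`, where it is the usual commutator. Each pulled-back
field carries the factor `N`, and the derivatives of these two factors combine into `lieBr`. -/
theorem triv_mlieBracket {X Y : ∀ g : G, Tan E g} {g : G} (hX : LeftDiffAt E (triv X) g)
    (hY : LeftDiffAt E (triv Y) g) :
    triv (VectorField.mlieBracket 𝓘(ℝ, E) X Y) g =
      leftDeriv E (triv Y) g (triv X g) - leftDeriv E (triv X) g (triv Y g) +
        lieBr E G (triv X g) (triv Y g) := by
  have : CompleteSpace E := FiniteDimensional.complete ℝ E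
  have i3 : IsManifold 𝓘(ℝ, E) (minSmoothness ℝ 3) G :=
    (isManifold_of_lieGroup (E := E) (G := G)).of_le (by simp; norm_cast)
  have hg : g * param G (origin E G) = g := by simp
  have h1 := VectorField.mpullback_mlieBracket (I := 𝓘(ℝ, E)) (I' := 𝓘(ℝ, E)) (n := ∞)
    (f := fun v : E => g * param G v) (V := X) (W := Y) (x₀ := origin E G)
    (by simp only [hg]; exact mdifferentiableAt_of_leftDiffAt hX)
    (by simp only [hg]; exact mdifferentiableAt_of_leftDiffAt hY)
    (contMDiffAt_mul_param g) (by simp; norm_cast)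
  have h2 := mpullback_mul_param_eventually (E := E) g
  have h3 (Z : ∀ g : G, Tan E g) : (VectorField.mpullback 𝓘(ℝ, E) 𝓘(ℝ, E)
      (fun v : E => g * param G v) Z (origin E G) : E) = triv Z g := by
    refine (h2.self_of_nhds Z).trans ?_
    rw [param_origin, mul_one, leftDeriv_coord]
    rfl
  have h6 (V W : E → E) : (VectorField.mlieBracket 𝓘(ℝ, E) V W (origin E G) : E) =
      fderiv ℝ W (origin E G) (V (origin E G)) - fderiv ℝ V (origin E G) (W (origin E G)) := by
    have := congrFun (VectorField.mlieBracketWithin_eq_lieBracketWithin (𝕜 := ℝ) (V := V) (W := W)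
      (s := Set.univ)) (origin E G)
    rw [VectorField.lieBracketWithin_univ] at this
    exact this
  have key (Z : ∀ g : G, Tan E g) (hZ : LeftDiffAt E (triv Z) g) :
      HasFDerivAt (VectorField.mpullback 𝓘(ℝ, E) 𝓘(ℝ, E) (fun v : E => g * param G v) Z : E → E)
        (leftDeriv E (triv Z) g + (mulSecond E G).flip (triv Z g)) (origin E G) := by
    have h4 := (hasFDerivAt_leftDeriv_coord (E := E) (G := G)).clm_apply hZ.hasFDerivAt
    have h5 := h4.congr_of_eventuallyEq (f₁ := VectorField.mpullback 𝓘(ℝ, E) 𝓘(ℝ, E)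
      (fun v : E => g * param G v) Z) (h2.mono fun v hv => hv Z)
    refine h5.congr_fderiv ?_
    ext ξ
    simp [leftDeriv_coord]
  refine (h3 _).symm.trans (h1.trans ((h6 _ _).trans ?_))
  rw [(key X hX).fderiv, (key Y hY).fderiv, h3, h3, lieBr_apply]
  simp only [_root_.add_apply, ContinuousLinearMap.flip_apply]
  abel

end VectorFields

/-! ### Top-degree forms, determinants and traces -/

section TopForms

variable {E : Type*} [NormedAddCommGroup E] [NormedSpace ℝ E] [FiniteDimensional ℝ E] {n : ℕ}

theorem form_comp_det (hn : Module.finrank ℝ E = n) (ν : E [⋀^Fin n]→ₗ[ℝ] ℝ) (A : E →ₗ[ℝ] E)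
    (y : Fin n → E) : ν (fun i => A (y i)) = LinearMap.det A * ν y := by
  let b := Module.finBasisOfFinrankEq ℝ E hn
  have h (z : Fin n → E) : ν z = ν b * b.det z := by
    conv_lhs => rw [ν.eq_smul_basis_det b]
    simp
  have h2 := b.det_comp A y
  rw [h, h y]
  have h3 : b.det (fun i => A (y i)) = LinearMap.det A * b.det y := h2
  rw [h3]
  ring

theorem continuous_form (hn : Module.finrank ℝ E = n) (ν : E [⋀^Fin n]→ₗ[ℝ] ℝ) :
    Continuous ν := by
  let b := Module.finBasisOfFinrankEq ℝ E hn
  have h : (ν : (Fin n → E) → ℝ) = fun z => ν b * b.det z := by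
    ext z
    conv_lhs => rw [ν.eq_smul_basis_det b]
    simp
  rw [h]
  refine continuous_const.mul ?_
  refine Continuous.matrix_det (A := fun z => b.toMatrix z) (continuous_matrix fun i j => ?_)
  exact (LinearMap.continuous_of_finiteDimensional (b.coord i)).comp (continuous_apply j)

/-- A form of top degree as a continuous multilinear map. -/
def formL (hn : Module.finrank ℝ E = n) (ν : E [⋀^Fin n]→ₗ[ℝ] ℝ) :
    ContinuousMultilinearMap ℝ (fun _ : Fin n => E) ℝ :=
  { ν.toMultilinearMap with cont := continuous_form hn ν }

theorem hasFDerivAt_form (hn : Module.finrank ℝ E = n) (ν : E [⋀^Fin n]→ₗ[ℝ] ℝ)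
    {F : Type*} [NormedAddCommGroup F] [NormedSpace ℝ F] {y : Fin n → F → E}
    {y' : Fin n → F →L[ℝ] E} {x : F} (hy : ∀ i, HasFDerivAt (y i) (y' i) x) :
    ∃ D : F →L[ℝ] ℝ, HasFDerivAt (fun x => ν fun i => y i x) D x ∧
      ∀ ξ, D ξ = ∑ i, ν (Function.update (fun j => y j x) i (y' i ξ)) := by
  refine ⟨_, HasFDerivAt.multilinear_comp (formL hn ν) hy, fun ξ => ?_⟩
  simp only [_root_.sum_apply, ContinuousLinearMap.comp_apply]
  rfl

theorem contDiff_form (hn : Module.finrank ℝ E = n) (ν : E [⋀^Fin n]→ₗ[ℝ] ℝ) :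
    ContDiff ℝ ∞ ν :=
  (formL hn ν).contDiff

theorem det_update_basis (b : Module.Basis (Fin n) ℝ E) (i : Fin n) (v : E) :
    b.det (Function.update b i v) = b.repr v i := by
  rw [Module.Basis.det_apply, Module.Basis.toMatrix_update, Module.Basis.toMatrix_self,
    ← Matrix.cramer_apply, Matrix.cramer_one]
  rfl

theorem sum_det_update_basis (b : Module.Basis (Fin n) ℝ E) (T : E →ₗ[ℝ] E) :
    ∑ i, b.det (Function.update b i (T (b i))) = LinearMap.trace ℝ E T := by
  rw [LinearMap.trace_eq_matrix_trace ℝ b, Matrix.trace]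
  simp [det_update_basis, LinearMap.toMatrix_apply]

/-- Both sides are the derivative at `t = 0` of `ν((1 + tT) y) = det(1 + tT) ν(y)`. -/
theorem sum_form_update (hn : Module.finrank ℝ E = n) (ν : E [⋀^Fin n]→ₗ[ℝ] ℝ) (T : E →L[ℝ] E)
    (y : Fin n → E) :
    ∑ i, ν (Function.update y i (T (y i))) = LinearMap.trace ℝ E T * ν y := by
  let b := Module.finBasisOfFinrankEq ℝ E hn
  have hd (z : Fin n → E) (i : Fin n) : HasFDerivAt (fun t : ℝ => z i + t • T (z i))
      ((ContinuousLinearMap.id ℝ ℝ).smulRight (T (z i))) 0 :=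
    ((hasFDerivAt_id (𝕜 := ℝ) (0 : ℝ)).smul_const (T (z i))).const_add (z i)
  obtain ⟨D, hD, hD'⟩ := hasFDerivAt_form hn ν (hd y)
  obtain ⟨D₁, hD₁, hD₁'⟩ := hasFDerivAt_form hn b.det (hd b)
  have e (μ : E [⋀^Fin n]→ₗ[ℝ] ℝ) (z : Fin n → E) (t : ℝ) :
      μ (fun i => z i + t • T (z i)) = LinearMap.det (1 + t • T.toLinearMap) * μ z :=
    form_comp_det hn μ (1 + t • T.toLinearMap) z
  -- Since `b.det b = 1`, the function `det(1 + tT)` is `b.det` evaluated on the moved basis, and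
  -- its derivative is `D₁`.
  have h1 : HasFDerivAt (fun t : ℝ => ν fun i => y i + t • T (y i)) (ν y • D₁) 0 := by
    refine (hD₁.const_mul (ν y)).congr_of_eventuallyEq (Eventually.of_forall fun t => ?_)
    simp only [e, Module.Basis.det_self]
    ring
  have h2 := congrArg (fun L : ℝ →L[ℝ] ℝ => L 1) (hD.unique h1)
  simp only [hD', _root_.smul_apply, hD₁', zero_smul, add_zero, smul_eq_mul] at h2
  simp at h2
  rw [h2, mul_comm]
  congr 1
  exact sum_det_update_basis b T.toLinearMap

theorem contDiff_det : ContDiff ℝ ∞ (fun A : E →L[ℝ] E => LinearMap.det (A : E →ₗ[ℝ] E)) := by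
  let b := Module.finBasisOfFinrankEq ℝ E rfl
  have h : (fun A : E →L[ℝ] E => LinearMap.det (A : E →ₗ[ℝ] E)) =
      fun A => b.det (fun i => A (b i)) := by
    ext A
    have := form_comp_det rfl b.det (A : E →ₗ[ℝ] E) b
    exact (this.trans ((congrArg (LinearMap.det _ * ·) b.det_self).trans (mul_one _))).symm
  rw [h]
  exact (contDiff_form rfl b.det).comp
    (contDiff_pi.2 fun i => (ContinuousLinearMap.apply ℝ E (b i)).contDiff)

theorem hasFDerivAt_det_id : ∃ D : (E →L[ℝ] E) →L[ℝ] ℝ,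
    HasFDerivAt (fun A : E →L[ℝ] E => LinearMap.det (A : E →ₗ[ℝ] E)) D
      (ContinuousLinearMap.id ℝ E) ∧ ∀ T : E →L[ℝ] E, D T = LinearMap.trace ℝ E T := by
  let b := Module.finBasisOfFinrankEq ℝ E rfl
  have h : (fun A : E →L[ℝ] E => LinearMap.det (A : E →ₗ[ℝ] E)) =
      fun A => b.det (fun i => A (b i)) := by
    ext A
    have := form_comp_det rfl b.det (A : E →ₗ[ℝ] E) b
    exact (this.trans ((congrArg (LinearMap.det _ * ·) b.det_self).trans (mul_one _))).symm
  obtain ⟨D, hD, hD'⟩ := hasFDerivAt_form rfl b.det (x := ContinuousLinearMap.id ℝ E)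
    (fun i => (ContinuousLinearMap.apply ℝ E (b i)).hasFDerivAt)
  refine ⟨D, h ▸ hD, fun T => ?_⟩
  rw [hD']
  exact sum_det_update_basis b T.toLinearMap

/-- The top exterior power is a line on which `A` acts by the scalar `det A`. -/
theorem det_exteriorPower_map (hn : Module.finrank ℝ E = n) (A : E →ₗ[ℝ] E) :
    LinearMap.det (exteriorPower.map n A) = LinearMap.det A := by
  have h : exteriorPower.map n A = LinearMap.det A • LinearMap.id := by
    refine exteriorPower.linearMap_ext ?_
    ext1 m
    simp only [LinearMap.compAlternatingMap_apply, exteriorPower.map_apply_ιMulti,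
      LinearMap.smul_apply, LinearMap.id_apply]
    rw [← sub_eq_zero, ← Module.forall_dual_apply_eq_zero_iff ℝ]
    intro φ
    have := form_comp_det hn (φ.compAlternatingMap (exteriorPower.ιMulti ℝ n)) A m
    rw [map_sub, sub_eq_zero, map_smul]
    exact this
  rw [h, LinearMap.det_smul, exteriorPower.finrank_eq, hn]
  simp

end TopForms

/-! ### Lie derivative of a multiple of a left-invariant form -/

section LieDerivative

variable {E : Type*} [NormedAddCommGroup E] [NormedSpace ℝ E] [FiniteDimensional ℝ E]
  {G : Type*} [TopologicalSpace G] [ChartedSpace E G] [Group G] [LieGroup 𝓘(ℝ, E) ∞ G] {n : ℕ}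

theorem diff_apply_eq {u : G → ℝ} {g : G} (hu : LeftDiffAt E u g) (X : ∀ g : G, Tan E g) :
    diff E u g (X g) = leftDeriv E u g (triv X g) :=
  mder_apply_eq hu X

variable (E) in
/-- The trace of the adjoint representation of the Lie algebra. -/
def trAd (G : Type*) [TopologicalSpace G] [ChartedSpace E G] [Group G] (ξ : E) : ℝ :=
  LinearMap.trace ℝ E (lieBr E G ξ)

/-- The terms containing derivatives of the `Y i` cancel between the product rule and the brackets.
What remains inserts `Dx - ad_x` into each slot in turn, which produces its trace. -/
theorem lieDerivative_smul_leftForm (hn : Module.finrank ℝ E = n)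
    (ν : LieAlg E G [⋀^Fin n]→ₗ[ℝ] ℝ) {ρ : G → ℝ} {X : ∀ g : G, Tan E g}
    {Y : Fin n → ∀ g : G, Tan E g} {g : G} (hρ : LeftDiffAt E ρ g)
    (hX : LeftDiffAt E (triv X) g) (hY : ∀ i, IsSmoothVectorField (Y i)) :
    lieDerivative X (fun g => ρ g • leftForm ν g) Y g =
      (leftDeriv E ρ g (triv X g) + ρ g * (LinearMap.trace ℝ E (leftDeriv E (triv X) g)
        - trAd E G (triv X g))) * leftForm ν g (fun i => Y i g) := by
  let μ : E [⋀^Fin n]→ₗ[ℝ] ℝ := ν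
  have hform (g : G) (Z : Fin n → Tan E g) :
      leftForm ν g Z = μ (fun i => leftTransInv E g (Z i)) := rfl
  have hYd (i : Fin n) : LeftDiffAt E (triv (Y i)) g := ((contMDiff_triv (hY i)) g).leftDiffAt
  obtain ⟨D, hD, hD'⟩ := hasFDerivAt_form hn μ (fun i => (hYd i).hasFDerivAt)
  have hu : HasFDerivAt (fun v : E => (fun g => ρ g * μ (fun i => triv (Y i) g)) (g * param G v))
      _ (origin E G) := hρ.hasFDerivAt.mul hD
  have h1 : diff E (fun y => (ρ y • leftForm ν y) (fun i => Y i y)) g (X g) =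
      leftDeriv E (fun g => ρ g * μ (fun i => triv (Y i) g)) g (triv X g) :=
    diff_apply_eq (u := fun g => ρ g * μ (fun i => triv (Y i) g)) hu.differentiableAt X
  have h2 (i : Fin n) : (ρ g • leftForm ν g) (Function.update (fun j => Y j g) i
      (VectorField.mlieBracket 𝓘(ℝ, E) X (Y i) g)) =
      ρ g * (μ (Function.update (fun j => triv (Y j) g) i
        (leftDeriv E (triv (Y i)) g (triv X g))) -
        μ (Function.update (fun j => triv (Y j) g) i
        ((leftDeriv E (triv X) g - lieBr E G (triv X g)) (triv (Y i) g)))) := by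
    have h3 : (ρ g • leftForm ν g) (Function.update (fun j => Y j g) i
      (VectorField.mlieBracket 𝓘(ℝ, E) X (Y i) g)) = ρ g * μ (Function.update
        (fun j => triv (Y j) g) i (triv (VectorField.mlieBracket 𝓘(ℝ, E) X (Y i)) g)) := by
      refine congrArg (fun z => ρ g * μ z) ?_
      ext j
      by_cases hj : j = i
      · subst hj; simp [triv]; rfl
      · simp [hj, triv]; rfl
    rw [h3, triv_mlieBracket hX (hYd i), ← μ.map_update_sub]
    congr 3
    simp only [_root_.sub_apply]
    abel
  rw [lieDerivative, h1, Finset.sum_congr rfl (fun i _ => h2 i), ← Finset.mul_sum,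
    Finset.sum_sub_distrib, sum_form_update hn μ]
  have h4 : leftDeriv E (fun g => ρ g * μ (fun i => triv (Y i) g)) g (triv X g) =
      leftDeriv E ρ g (triv X g) * μ (fun i => triv (Y i) g) + ρ g * ∑ i,
        μ (Function.update (fun j => triv (Y j) g) i (leftDeriv E (triv (Y i)) g (triv X g))) := by
    rw [leftDeriv, hu.fderiv]
    simp only [_root_.add_apply, _root_.smul_apply, hD', param_origin, mul_one, smul_eq_mul]
    ring
  have h5 : LinearMap.trace ℝ E (leftDeriv E (triv X) g - lieBr E G (triv X g) : E →L[ℝ] E) =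
      LinearMap.trace ℝ E (leftDeriv E (triv X) g) - trAd E G (triv X g) := by
    rw [trAd, ← map_sub]; rfl
  have h6 : leftForm ν g (fun i => Y i g) = μ (fun i => triv (Y i) g) := rfl
  rw [h4, h5, h6]
  ring

end LieDerivative

/-! ### The function `f₀` and the volume form `√f₀ ν^l` -/

section Modular

variable {E : Type*} [NormedAddCommGroup E] [NormedSpace ℝ E] [FiniteDimensional ℝ E]
  {G : Type*} [TopologicalSpace G] [ChartedSpace E G] [Group G] [LieGroup 𝓘(ℝ, E) ∞ G] {n : ℕ}

theorem f₀_eq_det (hn : Module.finrank ℝ E = n) (g : G) :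
    f₀ E n g = LinearMap.det (adj E g : E →ₗ[ℝ] E) :=
  det_exteriorPower_map hn (adj E g : E →ₗ[ℝ] E)

theorem f₀_one (hn : Module.finrank ℝ E = n) : f₀ E n (1 : G) = 1 := by
  rw [f₀_eq_det hn, adj_one]
  exact LinearMap.det_id

theorem f₀_mul (hn : Module.finrank ℝ E = n) (g h : G) :
    f₀ E n (g * h) = f₀ E n g * f₀ E n h := by
  simp only [f₀_eq_det hn]
  rw [adj_mul, ← LinearMap.det_comp]
  rfl

theorem f₀_ne_zero (hn : Module.finrank ℝ E = n) (g : G) : f₀ E n g ≠ 0 := by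
  intro h
  have := f₀_mul hn g g⁻¹
  rw [mul_inv_cancel, f₀_one hn, h, zero_mul] at this
  exact one_ne_zero this

theorem contMDiff_f₀ (hn : Module.finrank ℝ E = n) :
    ContMDiff 𝓘(ℝ, E) 𝓘(ℝ, ℝ) ∞ (f₀ E n : G → ℝ) := by
  have h : (f₀ E n : G → ℝ) = fun g => LinearMap.det (adj E g : E →ₗ[ℝ] E) :=
    funext (f₀_eq_det hn)
  rw [h]
  exact fun g => ContDiffAt.contMDiffAt_comp
    (k := fun A : E →L[ℝ] E => LinearMap.det (A : E →ₗ[ℝ] E)) contDiff_det.contDiffAt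
    (contMDiffAt_adj g)

/-- On a connected group a continuous nowhere zero function with value `1` at `e` stays positive. -/
theorem f₀_pos [ConnectedSpace G] (hn : Module.finrank ℝ E = n) (g : G) : 0 < f₀ E n g := by
  by_contra! h
  obtain ⟨k, hk⟩ := mem_range_of_exists_le_of_exists_ge (contMDiff_f₀ (G := G) hn).continuous
    ⟨g, h⟩ ⟨1, by rw [f₀_one hn]; exact zero_le_one⟩
  exact f₀_ne_zero hn k hk

/-- As `f₀` is a homomorphism, only its derivative at `e` matters; there `d det = tr` and `d Ad =
ad`. -/
theorem leftDeriv_f₀ (hn : Module.finrank ℝ E = n) (g : G) (ξ : E) :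
    leftDeriv E (f₀ E n) g ξ = f₀ E n g * trAd E G ξ := by
  obtain ⟨D, hD, hD'⟩ := hasFDerivAt_det_id (E := E)
  have h1 := (contMDiffAt_adj (E := E) (1 : G)).leftDiffAt.hasFDerivAt
  simp only [one_mul, leftDeriv_adj_one] at h1
  have hD2 : HasFDerivAt (fun A : E →L[ℝ] E => LinearMap.det (A : E →ₗ[ℝ] E)) D
      (adj E (param G (origin E G))) := by
    rw [param_origin, adj_one]; exact hD
  have h2 := (hD2.comp (origin E G) h1).const_mul (f₀ E n g)
  have h3 : leftDeriv E (f₀ E n) g = f₀ E n g • D.comp (lieBr E G) := by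
    refine (h2.congr_of_eventuallyEq (Eventually.of_forall fun v => ?_)).fderiv
    rw [f₀_mul hn, f₀_eq_det hn (param G v)]
    rfl
  rw [h3]
  simp [hD', trAd]

theorem contMDiff_sqrt_f₀ [ConnectedSpace G] (hn : Module.finrank ℝ E = n) :
    ContMDiff 𝓘(ℝ, E) 𝓘(ℝ, ℝ) ∞ (fun g : G => √(f₀ E n g)) := fun g =>
  ContDiffAt.contMDiffAt_comp (k := Real.sqrt) (Real.contDiffAt_sqrt (f₀_ne_zero hn g))
    (contMDiff_f₀ hn g)

theorem leftDeriv_sqrt_f₀ [ConnectedSpace G] (hn : Module.finrank ℝ E = n) (g : G) (ξ : E) :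
    leftDeriv E (fun g : G => √(f₀ E n g)) g ξ = √(f₀ E n g) * (trAd E G ξ / 2) := by
  have h1 := (contMDiff_f₀ (G := G) hn g).leftDiffAt.hasFDerivAt
  have h2 := h1.sqrt (by simpa using f₀_ne_zero hn g)
  have h3 := f₀_pos hn g
  rw [leftDeriv, h2.fderiv]
  simp only [_root_.smul_apply, leftDeriv_f₀ hn, param_origin, mul_one, smul_eq_mul]
  have h4 : √(f₀ E n g) ≠ 0 := (Real.sqrt_pos.2 h3).ne'
  field_simp
  rw [Real.sq_sqrt h3.le]

theorem isVolumeForm_sqrt_f₀ [ConnectedSpace G] (hn : Module.finrank ℝ E = n)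
    {ν : LieAlg E G [⋀^Fin n]→ₗ[ℝ] ℝ} (hν : ν ≠ 0) :
    IsVolumeForm (fun g : G => √(f₀ E n g) • leftForm ν g) where
  top_degree := hn.symm
  smooth Y hY := by
    let μ : E [⋀^Fin n]→ₗ[ℝ] ℝ := ν
    have h : (fun g : G => (√(f₀ E n g) • leftForm ν g) fun i => Y i g) =
        fun g => √(f₀ E n g) * μ (fun i => triv (Y i) g) := rfl
    rw [IsSmoothFun, h]
    refine (contMDiff_sqrt_f₀ hn).mul fun g => ?_
    refine ContDiffAt.contMDiffAt_comp (u := fun g i => triv (Y i) g)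
      (contDiff_form hn μ).contDiffAt ?_
    exact contMDiffAt_pi_space.2 fun i => contMDiff_triv (hY i) g
  ne_zero g h := by
    refine hν ?_
    ext y
    have h1 := DFunLike.congr_fun h (fun i => leftTrans E g (y i))
    have h2 : √(f₀ E n g) * ν y = 0 := by
      refine Eq.trans (congrArg (fun z => √(f₀ E n g) * ν z) ?_) h1
      ext i
      exact (leftTransInv_leftTrans (E := E) g (y i)).symm
    exact (mul_eq_zero.1 h2).resolve_left (Real.sqrt_pos.2 (f₀_pos hn g)).ne'

end Modular

/-! ### Linear algebra of `sharp`, trace and push-forward -/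

section Sharp

variable {E : Type*} [NormedAddCommGroup E] [NormedSpace ℝ E] [FiniteDimensional ℝ E]

theorem eq_of_dual_eq {x y : E} (h : ∀ β : E →L[ℝ] ℝ, β x = β y) : x = y :=
  (SeparatingDual.eq_iff_forall_dual_eq (R := ℝ)).2 h

variable (E) in
/-- The map `sharp` as a continuous bilinear map. -/
def sharpL : ((E →L[ℝ] ℝ) →L[ℝ] (E →L[ℝ] ℝ) →L[ℝ] ℝ) →L[ℝ] (E →L[ℝ] ℝ) →L[ℝ] E :=
  LinearMap.toContinuousLinearMap
    { toFun := fun Q => LinearMap.toContinuousLinearMap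
        { toFun := fun α => sharp Q α
          map_add' := fun α β => eq_of_dual_eq fun γ => by simp [apply_sharp]
          map_smul' := fun c α => eq_of_dual_eq fun γ => by simp [apply_sharp] }
      map_add' := fun Q R => by
        ext α
        exact eq_of_dual_eq fun γ => by simp [apply_sharp]
      map_smul' := fun c Q => by
        ext α
        exact eq_of_dual_eq fun γ => by simp [apply_sharp] }

@[simp]
theorem apply_sharpL (Q : (E →L[ℝ] ℝ) →L[ℝ] (E →L[ℝ] ℝ) →L[ℝ] ℝ) (α β : E →L[ℝ] ℝ) :
    β (sharpL E Q α) = Q α β := apply_sharp Q α β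

variable (E) in
/-- The trace of endomorphisms as a continuous linear map. -/
def trL : (E →L[ℝ] E) →L[ℝ] ℝ :=
  LinearMap.toContinuousLinearMap
    { toFun := fun A => LinearMap.trace ℝ E (A : E →ₗ[ℝ] E)
      map_add' := fun A B => by simp
      map_smul' := fun c A => by simp }

theorem trL_apply (A : E →L[ℝ] E) : trL E A = LinearMap.trace ℝ E (A : E →ₗ[ℝ] E) := rfl

theorem trL_eq_sum {ι : Type*} [Fintype ι] (b : Module.Basis ι ℝ E) (A : E →L[ℝ] E) :
    trL E A = ∑ i, LinearMap.toContinuousLinearMap (b.coord i) (A (b i)) := by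
  classical
  rw [trL_apply, LinearMap.trace_eq_matrix_trace ℝ b, Matrix.trace]
  simp [LinearMap.toMatrix_apply]

theorem trL_conj {A B : E →L[ℝ] E} (h : B.comp A = ContinuousLinearMap.id ℝ E)
    (T : E →L[ℝ] E) : trL E (A.comp (T.comp B)) = trL E T := by
  have h1 := LinearMap.trace_mul_comm ℝ (A : E →ₗ[ℝ] E) ((T.comp B : E →L[ℝ] E) : E →ₗ[ℝ] E)
  have h2 : ((T.comp B).comp A) = T := by
    rw [ContinuousLinearMap.comp_assoc, h, ContinuousLinearMap.comp_id]
  calc trL E (A.comp (T.comp B)) = trL E ((T.comp B).comp A) := h1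
    _ = _ := by rw [h2]

theorem clm_eq_sum {ι : Type*} [Fintype ι] (b : Module.Basis ι ℝ E) (α : E →L[ℝ] ℝ) :
    α = ∑ i, α (b i) • LinearMap.toContinuousLinearMap (b.coord i) := by
  ext x
  conv_lhs => rw [← b.sum_repr x]
  rw [map_sum]
  simp [mul_comm]

/-- For an alternating `Q`, the trace of `Q^♯ ∘ K` changes sign when `K` is transposed. -/
theorem trL_sharpL_flip {Q : (E →L[ℝ] ℝ) →L[ℝ] (E →L[ℝ] ℝ) →L[ℝ] ℝ} (hQ : ∀ α, Q α α = 0)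
    (K : E →L[ℝ] E →L[ℝ] ℝ) :
    trL E ((sharpL E Q).comp K.flip) = - trL E ((sharpL E Q).comp K) := by
  let b := Module.finBasis ℝ E
  have anti (α β : E →L[ℝ] ℝ) : Q α β = - Q β α := by
    have := hQ (α + β)
    simp only [map_add, _root_.add_apply, hQ] at this
    linarith
  have h (K : E →L[ℝ] E →L[ℝ] ℝ) : trL E ((sharpL E Q).comp K) =
      ∑ j, ∑ i, K (b j) (b i) * Q (LinearMap.toContinuousLinearMap (b.coord i))
        (LinearMap.toContinuousLinearMap (b.coord j)) := by
    rw [trL_eq_sum b]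
    refine Finset.sum_congr rfl fun j _ => ?_
    rw [ContinuousLinearMap.comp_apply, apply_sharpL]
    conv_lhs => rw [clm_eq_sum b (K (b j))]
    simp only [map_sum, map_smul, _root_.sum_apply, _root_.smul_apply, smul_eq_mul]
  -- Exchanging the summation indices transposes `K` at the cost of transposing `Q`, which is a
  -- sign.
  rw [h, h, Finset.sum_comm, ← Finset.sum_neg_distrib]
  refine Finset.sum_congr rfl fun i _ => ?_
  rw [← Finset.sum_neg_distrib]
  refine Finset.sum_congr rfl fun j _ => ?_
  rw [ContinuousLinearMap.flip_apply, anti]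
  ring

/-- Product rule: `push` is linear in the tensor and quadratic in the map, hence three terms. -/
theorem hasFDerivAt_push {F : Type*} [NormedAddCommGroup F] [NormedSpace ℝ F]
    {B : F → E →L[ℝ] E} {B' : F →L[ℝ] E →L[ℝ] E}
    {Q : F → (E →L[ℝ] ℝ) →L[ℝ] (E →L[ℝ] ℝ) →L[ℝ] ℝ}
    {Q' : F →L[ℝ] (E →L[ℝ] ℝ) →L[ℝ] (E →L[ℝ] ℝ) →L[ℝ] ℝ} {x : F}
    (hB : HasFDerivAt B B' x) (hQ : HasFDerivAt Q Q' x) :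
    ∃ D : F →L[ℝ] (E →L[ℝ] ℝ) →L[ℝ] (E →L[ℝ] ℝ) →L[ℝ] ℝ,
      HasFDerivAt (fun v => push (B v) (Q v)) D x ∧ ∀ ξ α β, D ξ α β =
        Q' ξ (α.comp (B x)) (β.comp (B x)) + Q x (α.comp (B' ξ)) (β.comp (B x)) +
          Q x (α.comp (B x)) (β.comp (B' ξ)) := by
  let pre : (E →L[ℝ] E) →L[ℝ] (E →L[ℝ] ℝ) →L[ℝ] (E →L[ℝ] ℝ) :=
    (ContinuousLinearMap.compL ℝ E E ℝ).flip
  let pre₂ : ((E →L[ℝ] ℝ) →L[ℝ] (E →L[ℝ] ℝ)) →L[ℝ] ((E →L[ℝ] ℝ) →L[ℝ] ℝ) →L[ℝ]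
      ((E →L[ℝ] ℝ) →L[ℝ] ℝ) :=
    (ContinuousLinearMap.compL ℝ (E →L[ℝ] ℝ) (E →L[ℝ] ℝ) ℝ).flip
  have h1 := pre.hasFDerivAt.comp x hB
  have h2 := pre₂.hasFDerivAt.comp x h1
  have h3 := h2.clm_comp (hQ.clm_comp h1)
  refine ⟨_, h3, fun ξ α β => ?_⟩
  simp [pre, pre₂]
  ring

end Sharp

/-! ### Multiplicativity as a cocycle condition and its derivatives -/

section Poisson

variable {E : Type*} [NormedAddCommGroup E] [NormedSpace ℝ E]
  {G : Type*} [TopologicalSpace G] [ChartedSpace E G] [Group G] [LieGroup 𝓘(ℝ, E) ∞ G]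
  {P : TensorField2 E G}

/-- The value of a field of `2`-tensors at a point, as a `2`-tensor on the model space. -/
def tensorAt (P : TensorField2 E G) (g : G) : (E →L[ℝ] ℝ) →L[ℝ] (E →L[ℝ] ℝ) →L[ℝ] ℝ := P g

/-- Left translation disappears in the left trivialization, while right translation by `h` becomes
`Ad_{h⁻¹}`, because `(gh)⁻¹ x h = h⁻¹ (g⁻¹ x) h`. -/
theorem leftTriv_mul (hP : IsPoissonLie P) (g h : G) :
    leftTriv P (g * h) = leftTriv P h + push (adj E h⁻¹) (leftTriv P g) := by
  have h1 : (leftTransInv E (g * h)).comp (mder E E (fun x : G => g * x) h) =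
      leftTransInv E h := by
    rw [leftTransInv, ← mder_comp (f := fun x : G => g * x) rfl (mdifferentiableAt_mul_left _ _)
      (mdifferentiableAt_mul_left _ _), leftTransInv]
    congr 1
    ext x
    group
  have h2 : (leftTransInv E (g * h)).comp (mder E E (fun x : G => x * h) g) =
      (adj E h⁻¹).comp (leftTransInv E g) := by
    rw [leftTransInv, ← mder_comp (f := fun x : G => x * h) rfl (mdifferentiableAt_mul_left _ _)
      (mdifferentiableAt_mul_right _ _), adj, leftTransInv,
      ← mder_comp (inv_mul_cancel g) (mdifferentiableAt_conj _ _) (mdifferentiableAt_mul_left _ _)]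
    congr 1
    ext x
    group
  ext α β
  have h3 : leftTriv P (g * h) α β = P (g * h) (α.comp (leftTransInv E (g * h)))
      (β.comp (leftTransInv E (g * h))) := rfl
  have h4 : leftTriv P (g * h) α β =
      tensorAt P h (α.comp ((leftTransInv E (g * h)).comp (mder E E (fun x : G => g * x) h)))
        (β.comp ((leftTransInv E (g * h)).comp (mder E E (fun x : G => g * x) h))) +
      tensorAt P g (α.comp ((leftTransInv E (g * h)).comp (mder E E (fun x : G => x * h) g)))
        (β.comp ((leftTransInv E (g * h)).comp (mder E E (fun x : G => x * h) g))) := by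
    rw [h3, hP.multiplicative g h]
    rfl
  rw [h4, h1, h2]
  rfl

theorem leftTriv_one (hP : IsPoissonLie P) : leftTriv P (1 : G) = 0 := by
  have h := leftTriv_mul hP 1 1
  have h2 : push (adj E (1 : G)⁻¹) (leftTriv P 1) = leftTriv P 1 := by
    ext α β
    simp [adj_one]
  rw [h2, mul_one] at h
  simpa using h

theorem leftTriv_self (hP : IsPoissonLie P) (g : G) (α : E →L[ℝ] ℝ) :
    leftTriv P g α α = 0 :=
  hP.poisson.alternating g _

theorem bracket_eq_leftTriv {F K : G → ℝ} {g : G} (hF : LeftDiffAt E F g)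
    (hK : LeftDiffAt E K g) :
    bracket P F K g = leftTriv P g (leftDeriv E F g) (leftDeriv E K g) := by
  have h1 : diff E F g = (leftDeriv E F g).comp (leftTransInv E g) :=
    mder_eq_leftDeriv_comp hF.mdifferentiableAt
  have h2 : diff E K g = (leftDeriv E K g).comp (leftTransInv E g) :=
    mder_eq_leftDeriv_comp hK.mdifferentiableAt
  rw [bracket, h1, h2]
  rfl

variable [FiniteDimensional ℝ E]

/-- Smoothness of `P` is tested on functions defined on all of `G`, so the chart is cut off by a
bump function. -/
theorem exists_smooth_extension_coord [T2Space G] : ∃ Θ : G → E,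
    ContMDiff 𝓘(ℝ, E) 𝓘(ℝ, E) ∞ Θ ∧ leftDeriv E Θ 1 = ContinuousLinearMap.id ℝ E := by
  obtain ⟨f⟩ : Nonempty (SmoothBumpFunction 𝓘(ℝ, E) (1 : G)) := inferInstance
  refine ⟨fun g => f g • coord E g, f.contMDiff_smul fun g hg =>
    (contMDiffAt_coord_of_mem hg).contMDiffWithinAt, ?_⟩
  rw [← leftDeriv_coord (E := E) (G := G), leftDeriv, leftDeriv]
  refine Filter.EventuallyEq.fderiv_eq ?_
  filter_upwards [(tendsto_mul_param (1 : G)).eventually f.eventuallyEq_one] with v hv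
  rw [hv]
  simp

/-- Differentiability of `π` has to be recovered from smoothness of brackets of functions, using the
components of `Θ` as test functions. -/
theorem leftDiffAt_leftTriv_one [T2Space G] (hP : IsPoissonLie P) :
    LeftDiffAt E (leftTriv P) (1 : G) := by
  have : CompleteSpace E := FiniteDimensional.complete ℝ E
  obtain ⟨Θ, hΘ, hΘ1⟩ := exists_smooth_extension_coord (E := E) (G := G)
  have hα (α : E →L[ℝ] ℝ) : IsSmoothFun E (fun g => α (Θ g)) := fun g =>
    ContDiffAt.contMDiffAt_comp (k := α) α.contDiff.contDiffAt (hΘ g)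
  have hd (α : E →L[ℝ] ℝ) (g : G) :
      leftDeriv E (fun g => α (Θ g)) g = α.comp (leftDeriv E Θ g) :=
    (α.hasFDerivAt.comp (origin E G) (hΘ g).leftDiffAt.hasFDerivAt).fderiv
  -- The entries of `Q` are the brackets `{α ∘ Θ, β ∘ Θ}`, hence smooth.
  let Q : E → (E →L[ℝ] ℝ) →L[ℝ] (E →L[ℝ] ℝ) →L[ℝ] ℝ := fun v =>
    push (leftDeriv E Θ (param G v)) (leftTriv P (param G v))
  have hQ : ContDiffOn ℝ ∞ Q (extChartAt 𝓘(ℝ, E) (1 : G)).target := by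
    refine contDiffOn_clm_apply.2 fun α => contDiffOn_clm_apply.2 fun β => ?_
    have h1 : ContMDiffOn 𝓘(ℝ, E) 𝓘(ℝ, ℝ) ∞ (fun v : E =>
        bracket P (fun g => α (Θ g)) (fun g => β (Θ g)) (param G v))
        (extChartAt 𝓘(ℝ, E) (1 : G)).target := fun v hv =>
      (ContMDiffAt.comp v (hP.poisson.smooth _ _ (hα α) (hα β) (param G v))
        (contMDiffAt_param_of_mem hv)).contMDiffWithinAt
    refine h1.contDiffOn.congr fun v hv => ?_
    rw [bracket_eq_leftTriv (hα α _).leftDiffAt (hα β _).leftDiffAt, hd, hd]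
    rfl
  have hQ' : DifferentiableAt ℝ Q (origin E G) :=
    (hQ.contDiffAt (extChartAt_target_mem_nhds (1 : G))).differentiableAt (by simp)
  have hA := (contMDiffAt_leftDeriv (E := E) (hΘ 1)).leftDiffAt
  have hA' : DifferentiableAt ℝ (fun v : E => (leftDeriv E Θ (1 * param G v)).inverse)
      (origin E G) := by
    have h1 : (leftDeriv E Θ (1 * param G (origin E G))).IsInvertible := by
      rw [param_origin, mul_one, hΘ1]
      exact ⟨ContinuousLinearEquiv.refl ℝ E, rfl⟩
    exact DifferentiableAt.comp (f := fun v : E => leftDeriv E Θ (1 * param G v)) (origin E G)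
      ((h1.contDiffAt_map_inverse (n := 1)).differentiableAt (by simp)) hA
  -- Pushing `Q` forward by the inverse of `DΘ`, which exists near the identity, gives back `π`.
  obtain ⟨D, hD, -⟩ := hasFDerivAt_push hA'.hasFDerivAt hQ'.hasFDerivAt
  refine hD.differentiableAt.congr_of_eventuallyEq ?_
  have h3 : ∀ᶠ v in 𝓝 (origin E G), ∃ e : E ≃L[ℝ] E, (e : E →L[ℝ] E) =
      leftDeriv E Θ (1 * param G v) := by
    have := DifferentiableAt.continuousAt hA
    rw [ContinuousAt, param_origin, mul_one, hΘ1] at this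
    exact this (ContinuousLinearEquiv.nhds (ContinuousLinearEquiv.refl ℝ E))
  filter_upwards [h3] with v ⟨e, he⟩
  simp only [one_mul] at he ⊢
  ext α β
  simp only [push_apply, Q, ← he, ContinuousLinearMap.inverse_equiv]
  congr 2
  · ext x
    simp
  · ext x
    simp

/-- The cobracket, as a map on the model space. -/
def cobr (P : TensorField2 E G) : E →L[ℝ] (E →L[ℝ] ℝ) →L[ℝ] (E →L[ℝ] ℝ) →L[ℝ] ℝ :=
  leftDeriv E (leftTriv P) (1 : G)

theorem cobracket_eq [T2Space G] (hP : IsPoissonLie P) : cobracket P = cobr P :=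
  leftDeriv_one (leftDiffAt_leftTriv_one hP)

/-- Obtained by differentiating `Ad_g Ad_{g⁻¹} = 1` at the identity. -/
theorem hasFDerivAt_adj_inv :
    HasFDerivAt (fun v : E => adj E (param G v)⁻¹) (-lieBr E G) (origin E G) := by
  have h1 : ContMDiffAt 𝓘(ℝ, E) 𝓘(ℝ, E →L[ℝ] E) ∞ (fun g : G => adj E g⁻¹) 1 :=
    ContMDiffAt.comp_of_eq (contMDiffAt_adj (1 : G)) contMDiffAt_id.inv (by simp)
  have h2 := h1.leftDiffAt.hasFDerivAt
  have h3 := (contMDiffAt_adj (E := E) (1 : G)).leftDiffAt.hasFDerivAt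
  simp only [one_mul, leftDeriv_adj_one] at h2 h3
  have h4 := h3.clm_comp h2
  simp only [adj_comp_adj_inv] at h4
  have h5 := h4.unique (hasFDerivAt_const _ _)
  simp only [param_origin, inv_one, adj_one] at h5
  have h6 : leftDeriv E (fun g : G => adj E g⁻¹) 1 = -lieBr E G := by
    ext ξ η
    have := congrArg (fun T : E →L[ℝ] E →L[ℝ] E => T ξ η) h5
    simp at this
    simpa using eq_neg_of_add_eq_zero_left this
  rwa [h6] at h2

/-- Differentiating `π(gh) = π(h) + Ad_{h⁻¹} π(g)` at `h = e` both carries differentiability from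
`e` to `g` and gives the formula. -/
theorem hasFDerivAt_leftTriv [T2Space G] (hP : IsPoissonLie P) (g : G) :
    ∃ D : E →L[ℝ] (E →L[ℝ] ℝ) →L[ℝ] (E →L[ℝ] ℝ) →L[ℝ] ℝ,
      HasFDerivAt (fun v : E => leftTriv P (g * param G v)) D (origin E G) ∧
      ∀ ξ α β, D ξ α β = cobr P ξ α β - leftTriv P g (α.comp (lieBr E G ξ)) β -
        leftTriv P g α (β.comp (lieBr E G ξ)) := by
  obtain ⟨D, hD, hD'⟩ := hasFDerivAt_push (hasFDerivAt_adj_inv (E := E) (G := G))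
    (hasFDerivAt_const (leftTriv P g) (origin E G))
  have h1 := (leftDiffAt_leftTriv_one hP).hasFDerivAt
  simp only [one_mul] at h1
  refine ⟨_, (h1.add hD).congr_of_eventuallyEq (Eventually.of_forall fun v =>
    leftTriv_mul hP g (param G v)), fun ξ α β => ?_⟩
  simp only [_root_.add_apply, hD', param_origin, inv_one, adj_one]
  simp [cobr]
  abel

theorem leftDiffAt_leftTriv [T2Space G] (hP : IsPoissonLie P) (g : G) :
    LeftDiffAt E (leftTriv P) g := by
  obtain ⟨D, hD, -⟩ := hasFDerivAt_leftTriv hP g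
  exact hD.differentiableAt

theorem leftDeriv_leftTriv [T2Space G] (hP : IsPoissonLie P) (g : G) (ξ : E)
    (α β : E →L[ℝ] ℝ) :
    leftDeriv E (leftTriv P) g ξ α β = cobr P ξ α β -
      leftTriv P g (α.comp (lieBr E G ξ)) β - leftTriv P g α (β.comp (lieBr E G ξ)) := by
  obtain ⟨D, hD, hD'⟩ := hasFDerivAt_leftTriv hP g
  rw [leftDeriv, hD.fderiv, hD']

/-- This is the derivative at `h = e` of `π(g h g⁻¹) = π(g⁻¹) + Ad_g π(gh)`, the second consequence
of multiplicativity. -/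
theorem cobr_adj [T2Space G] (hP : IsPoissonLie P) (g : G) (ξ : E) (α β : E →L[ℝ] ℝ) :
    cobr P (adj E g ξ) α β =
      leftDeriv E (leftTriv P) g ξ (α.comp (adj E g)) (β.comp (adj E g)) := by
  have h1 := fderiv_conj (leftDiffAt_leftTriv_one hP) g
  obtain ⟨D, hD, hD'⟩ := hasFDerivAt_push (hasFDerivAt_const (adj E g) (origin E G))
    (leftDiffAt_leftTriv hP g).hasFDerivAt
  have h2 := hD.const_add (leftTriv P g⁻¹)
  have h3 : (fun v : E => leftTriv P (g * param G v * g⁻¹)) = fun v =>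
      leftTriv P g⁻¹ + push (adj E g) (leftTriv P (g * param G v)) := by
    ext1 v
    rw [leftTriv_mul hP, inv_inv]
  rw [h3] at h1
  have h4 := congrArg (fun T : E →L[ℝ] (E →L[ℝ] ℝ) →L[ℝ] (E →L[ℝ] ℝ) →L[ℝ] ℝ => T ξ α β)
    (h1.unique h2)
  simp only [hD', ContinuousLinearMap.comp_apply] at h4
  rw [cobr, h4]
  simp

end Poisson

/-! ### The modular character and the divergence of Hamiltonian fields -/

section ModularCharacter

variable {E : Type*} [NormedAddCommGroup E] [NormedSpace ℝ E] [FiniteDimensional ℝ E]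
  {G : Type*} [TopologicalSpace G] [ChartedSpace E G] [Group G] [LieGroup 𝓘(ℝ, E) ∞ G]
  {P : TensorField2 E G}

/-- The modular character `α ↦ tr(ad_α)` of the dual Lie algebra, on the dual of the model
space. -/
def modChar (P : TensorField2 E G) : (E →L[ℝ] ℝ) →L[ℝ] ℝ :=
  (trL E).comp ((sharpL E).comp (cobr P)).flip

/-- `ad_α` is the transpose of the endomorphism `ξ ↦ δ(ξ)^♯ α` of `𝔤`, and transposition keeps the
trace. -/
theorem trace_dualAd [T2Space G] (hP : IsPoissonLie P) (α : DualLieAlg E G) :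
    LinearMap.trace ℝ (DualLieAlg E G) (dualAd P α) = modChar P α := by
  let a : E →L[ℝ] ℝ := α
  let T : (E →L[ℝ] ℝ) →ₗ[ℝ] (E →L[ℝ] ℝ) := dualAd P α
  let M : E →L[ℝ] E := ((sharpL E).comp (cobr P)).flip a
  let e : (E →ₗ[ℝ] ℝ) ≃ₗ[ℝ] (E →L[ℝ] ℝ) := LinearMap.toContinuousLinearMap
  have h1 : T = e.conj (Module.Dual.transpose (R := ℝ) (M : E →ₗ[ℝ] E)) := by
    ext β ξ
    have h2 : T β ξ = cobracket P ξ α β := rfl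
    have h3 : T β ξ = cobr P ξ a β := by
      rw [h2, cobracket_eq hP]
      rfl
    rw [h3, ← apply_sharpL]
    rfl
  have h4 : LinearMap.trace ℝ (E →L[ℝ] ℝ) T = LinearMap.trace ℝ E (M : E →ₗ[ℝ] E) := by
    rw [h1, LinearMap.trace_conj']
    exact LinearMap.trace_transpose' (M : E →ₗ[ℝ] E)
  exact h4

theorem triv_hamiltonian {F : G → ℝ} {g : G} (hF : LeftDiffAt E F g) :
    triv (hamiltonian P F) g = sharpL E (leftTriv P g) (leftDeriv E F g) := by
  refine eq_of_dual_eq fun β => ?_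
  rw [apply_sharpL]
  have h1 : diff E F g = (leftDeriv E F g).comp (leftTransInv E g) :=
    mder_eq_leftDeriv_comp hF.mdifferentiableAt
  have h2 : β (triv (hamiltonian P F) g) = P g (diff E F g) (β.comp (leftTransInv E g)) :=
    apply_sharp (P g) (diff E F g) (β.comp (leftTransInv E g))
  rw [h2, h1]
  rfl

variable (G) in
/-- The trace of `ξ ↦ Q^♯(φ ∘ ad_ξ)`. -/
def lieTrace (Q : (E →L[ℝ] ℝ) →L[ℝ] (E →L[ℝ] ℝ) →L[ℝ] ℝ) (φ : E →L[ℝ] ℝ) : ℝ :=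
  trL E ((sharpL E Q).comp ((ContinuousLinearMap.compL ℝ E E ℝ φ).comp (lieBr E G)))

/-- Put `x = π^♯ φ`. In the formula for `Dπ` the last term `-π(φ, β ∘ ad_ξ)` is `-β([ξ, x]) = β([x,
ξ])`, so it contributes `tr ad_x`; the other two are `χ` and `-lieTrace` by definition. -/
theorem trL_sharpL_leftDeriv_leftTriv [T2Space G] (hP : IsPoissonLie P) (g : G)
    (φ : E →L[ℝ] ℝ) :
    trL E (((sharpL E).comp (leftDeriv E (leftTriv P) g)).flip φ) =
      modChar P φ - lieTrace G (leftTriv P g) φ + trAd E G (sharpL E (leftTriv P g) φ) := by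
  have h : ((sharpL E).comp (leftDeriv E (leftTriv P) g)).flip φ =
      ((sharpL E).comp (cobr P)).flip φ -
        (sharpL E (leftTriv P g)).comp ((ContinuousLinearMap.compL ℝ E E ℝ φ).comp (lieBr E G)) +
        lieBr E G (sharpL E (leftTriv P g) φ) := by
    ext ξ
    refine eq_of_dual_eq fun β => ?_
    have h2 : β (lieBr E G ξ (sharpL E (leftTriv P g) φ)) =
        leftTriv P g φ (β.comp (lieBr E G ξ)) :=
      apply_sharpL (leftTriv P g) φ (β.comp (lieBr E G ξ))
    simp only [ContinuousLinearMap.flip_apply, ContinuousLinearMap.comp_apply, _root_.add_apply,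
      _root_.sub_apply, map_add, map_sub, apply_sharpL, ContinuousLinearMap.compL_apply]
    rw [lieBr_swap, map_neg, h2, leftDeriv_leftTriv hP]
    ring
  rw [h, map_add, map_sub]
  rfl

/-- Conjugation by `Ad_g` turns this operator into the cobracket one by `cobr_adj`, without changing
the trace. -/
theorem trL_sharpL_leftDeriv_leftTriv_adj [T2Space G] (hP : IsPoissonLie P) (g : G)
    (α : E →L[ℝ] ℝ) :
    trL E (((sharpL E).comp (leftDeriv E (leftTriv P) g)).flip (α.comp (adj E g))) =
      modChar P α := by
  rw [← trL_conj (adj_inv_comp_adj (E := E) g)]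
  have h : (adj E g).comp ((((sharpL E).comp (leftDeriv E (leftTriv P) g)).flip
      (α.comp (adj E g))).comp (adj E g⁻¹)) = ((sharpL E).comp (cobr P)).flip α := by
    ext ξ
    refine eq_of_dual_eq fun β => ?_
    have h1 : adj E g (adj E g⁻¹ ξ) = ξ := DFunLike.congr_fun (adj_comp_adj_inv g) ξ
    have h2 := cobr_adj hP g (adj E g⁻¹ ξ) α β
    rw [h1] at h2
    simp only [ContinuousLinearMap.flip_apply, ContinuousLinearMap.comp_apply, apply_sharpL]
    rw [h2]
    exact apply_sharpL _ _ (β.comp (adj E g))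
  rw [h]
  rfl

/-- Only the antisymmetric part of the second derivative contributes, and that part is `dF ∘ [·,·] /
2`. -/
theorem trL_sharpL_leftDeriv_leftDeriv [T2Space G] (hP : IsPoissonLie P) {F : G → ℝ} {g : G}
    (hF : ContMDiffAt 𝓘(ℝ, E) 𝓘(ℝ, ℝ) ∞ F g) :
    trL E ((sharpL E (leftTriv P g)).comp (leftDeriv E (leftDeriv E F) g)) =
      lieTrace G (leftTriv P g) (leftDeriv E F g) / 2 := by
  have h := trL_sharpL_flip (leftTriv_self hP g) (leftDeriv E (leftDeriv E F) g)
  have h2 : (ContinuousLinearMap.compL ℝ E E ℝ (leftDeriv E F g)).comp (lieBr E G) =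
      leftDeriv E (leftDeriv E F) g - (leftDeriv E (leftDeriv E F) g).flip := by
    ext ξ η
    exact (leftDeriv_leftDeriv_sub hF ξ η).symm
  rw [lieTrace, h2, ContinuousLinearMap.comp_sub, map_sub, h]
  ring

theorem hasFDerivAt_triv_hamiltonian [T2Space G] (hP : IsPoissonLie P) {F : G → ℝ}
    (hF : IsSmoothFun E F) (g : G) :
    HasFDerivAt (fun v : E => triv (hamiltonian P F) (g * param G v))
      (((sharpL E).comp (leftDeriv E (leftTriv P) g)).flip (leftDeriv E F g) +
        (sharpL E (leftTriv P g)).comp (leftDeriv E (leftDeriv E F) g)) (origin E G) := by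
  have h1 := (sharpL E).hasFDerivAt.comp (origin E G) (leftDiffAt_leftTriv hP g).hasFDerivAt
  have h2 := h1.clm_apply (contMDiffAt_leftDeriv (hF g)).leftDiffAt.hasFDerivAt
  have h3 : (fun v : E => triv (hamiltonian P F) (g * param G v)) = fun v =>
      sharpL E (leftTriv P (g * param G v)) (leftDeriv E F (g * param G v)) :=
    funext fun v => triv_hamiltonian (hF _).leftDiffAt
  rw [h3]
  refine h2.congr_fderiv ?_
  simp only [Function.comp_apply, param_origin, mul_one]
  rw [add_comm]

theorem leftDiffAt_triv_hamiltonian [T2Space G] (hP : IsPoissonLie P) {F : G → ℝ}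
    (hF : IsSmoothFun E F) (g : G) : LeftDiffAt E (triv (hamiltonian P F)) g :=
  (hasFDerivAt_triv_hamiltonian hP hF g).differentiableAt

theorem trace_leftDeriv_hamiltonian [T2Space G] (hP : IsPoissonLie P) {F : G → ℝ}
    (hF : IsSmoothFun E F) (g : G) :
    LinearMap.trace ℝ E (leftDeriv E (triv (hamiltonian P F)) g) =
      modChar P (leftDeriv E F g) - lieTrace G (leftTriv P g) (leftDeriv E F g) / 2 +
        trAd E G (triv (hamiltonian P F) g) := by
  rw [← trL_apply, leftDeriv, (hasFDerivAt_triv_hamiltonian hP hF g).fderiv, map_add,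
    trL_sharpL_leftDeriv_leftTriv hP, trL_sharpL_leftDeriv_leftDeriv hP (hF g),
    triv_hamiltonian (hF g).leftDiffAt]
  ring

theorem trace_leftDeriv_hamiltonian_adj [T2Space G] (hP : IsPoissonLie P) {F : G → ℝ}
    (hF : IsSmoothFun E F) (g : G) :
    LinearMap.trace ℝ E (leftDeriv E (triv (hamiltonian P F)) g) =
      modChar P ((leftDeriv E F g).comp (adj E g⁻¹)) +
        lieTrace G (leftTriv P g) (leftDeriv E F g) / 2 := by
  have h := trL_sharpL_leftDeriv_leftTriv_adj hP g ((leftDeriv E F g).comp (adj E g⁻¹))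
  rw [ContinuousLinearMap.comp_assoc, adj_inv_comp_adj, ContinuousLinearMap.comp_id] at h
  rw [← trL_apply, leftDeriv, (hasFDerivAt_triv_hamiltonian hP hF g).fderiv, map_add, h,
    trL_sharpL_leftDeriv_leftDeriv hP (hF g)]

/-- The two expressions contain `lieTrace` with opposite signs, so it drops out of their average. -/
theorem trace_leftDeriv_hamiltonian_of_modChar_eq_zero [T2Space G] (hP : IsPoissonLie P)
    (h0 : modChar P = 0) {F : G → ℝ} (hF : IsSmoothFun E F) (g : G) :
    LinearMap.trace ℝ E (leftDeriv E (triv (hamiltonian P F)) g) =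
      trAd E G (triv (hamiltonian P F) g) / 2 := by
  have h1 := trace_leftDeriv_hamiltonian hP hF g
  have h2 := trace_leftDeriv_hamiltonian_adj hP hF g
  simp only [h0, _root_.zero_apply] at h1 h2
  linarith

theorem preserves_sqrt_f₀ [T2Space G] [ConnectedSpace G] {n : ℕ} (hn : Module.finrank ℝ E = n)
    (hP : IsPoissonLie P) (h0 : modChar P = 0) (ν : LieAlg E G [⋀^Fin n]→ₗ[ℝ] ℝ) {F : G → ℝ}
    (hF : IsSmoothFun E F) :
    Preserves (hamiltonian P F) (fun g : G => √(f₀ E n g) • leftForm ν g) := by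
  intro Y hY g
  rw [lieDerivative_smul_leftForm hn ν (contMDiff_sqrt_f₀ hn g).leftDiffAt
    (leftDiffAt_triv_hamiltonian hP hF g) hY, leftDeriv_sqrt_f₀ hn,
    trace_leftDeriv_hamiltonian_of_modChar_eq_zero hP h0 hF]
  ring

/-- The factor is the ratio of the values of `Φ` at `g` and at `e` on a left-invariant frame, smooth
because the frame is. -/
theorem exists_eq_smul_leftForm {n : ℕ} {Φ : ∀ g : G, Tan E g [⋀^Fin n]→ₗ[ℝ] ℝ}
    (hΦ : IsVolumeForm Φ) : ∃ h : G → ℝ, ContMDiff 𝓘(ℝ, E) 𝓘(ℝ, ℝ) ∞ h ∧ (∀ g, h g ≠ 0) ∧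
      Φ = fun g => h g • leftForm (Φ 1) g := by
  let b := Module.finBasisOfFinrankEq ℝ E hΦ.top_degree.symm
  let Y : Fin n → ∀ g : G, Tan E g := fun i g => leftTrans E g (b i)
  let μ (g : G) : E [⋀^Fin n]→ₗ[ℝ] ℝ := Φ g
  have hY (i : Fin n) : IsSmoothVectorField (Y i) := by
    refine isSmoothVectorField_of_triv ?_
    have : triv (Y i) = fun _ : G => b i := funext fun g => leftTransInv_leftTrans g (b i)
    rw [this]
    exact contMDiff_const
  have hc : μ 1 b ≠ 0 := (AlternatingMap.map_basis_ne_zero_iff b (μ 1)).2 (hΦ.ne_zero 1)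
  have key (g : G) : Φ g = (μ g (fun i => leftTrans E g (b i)) / μ 1 b) • leftForm (Φ 1) g := by
    let e : E ≃ₗ[ℝ] E := LinearEquiv.ofLinearMap (leftTrans E g : E →ₗ[ℝ] E) (leftTransInv E g)
      (LinearMap.ext fun x => leftTrans_leftTransInv g x)
      (LinearMap.ext fun x => leftTransInv_leftTrans g x)
    have h1 : μ g = (μ g (fun i => leftTrans E g (b i)) / μ 1 b) •
        (μ 1).compLinearMap (leftTransInv E g : E →ₗ[ℝ] E) := by
      rw [← sub_eq_zero, ← AlternatingMap.map_basis_eq_zero_iff (b.map e)]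
      have h2 : (⇑(b.map e) : Fin n → E) = fun i => leftTrans E g (b i) := by
        ext i
        simp [e]
      rw [h2]
      simp only [AlternatingMap.sub_apply, AlternatingMap.smul_apply,
        AlternatingMap.compLinearMap_apply, ContinuousLinearMap.coe_coe, smul_eq_mul]
      have h3 : (fun i => leftTransInv E g (leftTrans E g (b i))) = b :=
        funext fun i => leftTransInv_leftTrans g (b i)
      rw [h3]
      field_simp
      ring
    exact h1
  refine ⟨fun g => μ g (fun i => leftTrans E g (b i)) / μ 1 b, ?_, fun g h0 => ?_, funext key⟩
  · have h1 : ContMDiff 𝓘(ℝ, E) 𝓘(ℝ, ℝ) ∞ (fun g => μ g (fun i => leftTrans E g (b i))) :=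
      hΦ.smooth Y hY
    simp only [div_eq_mul_inv]
    exact h1.mul contMDiff_const
  · have h1 := key g
    simp only [h0, zero_smul] at h1
    exact hΦ.ne_zero g h1

/-- The invariance equation is differentiated at `e`; all terms other than `χ(dH)` vanish there to
second order. -/
theorem modChar_leftDeriv_leftDeriv [T2Space G] {n : ℕ} (hP : IsPoissonLie P) {H : G → ℝ}
    (hH : IsSmoothFun E H) (hc : leftDeriv E H 1 = 0)
    {Φ : ∀ g : G, Tan E g [⋀^Fin n]→ₗ[ℝ] ℝ} (hΦ : IsVolumeForm Φ)
    (hpres : Preserves (hamiltonian P H) Φ) (ξ : E) :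
    modChar P (leftDeriv E (leftDeriv E H) (1 : G) ξ) = 0 := by
  obtain ⟨h, hh, hh0, hΦh⟩ := exists_eq_smul_leftForm hΦ
  let b := Module.finBasisOfFinrankEq ℝ E hΦ.top_degree.symm
  let Y : Fin n → ∀ g : G, Tan E g := fun i g => leftTrans E g (b i)
  have hY (i : Fin n) : IsSmoothVectorField (Y i) := by
    refine isSmoothVectorField_of_triv ?_
    have : triv (Y i) = fun _ : G => b i := funext fun g => leftTransInv_leftTrans g (b i)
    rw [this]
    exact contMDiff_const
  have hb (g : G) : leftForm (Φ 1) g (fun i => Y i g) ≠ 0 := by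
    let μ : E [⋀^Fin n]→ₗ[ℝ] ℝ := Φ 1
    have h1 : leftForm (Φ 1) g (fun i => Y i g) =
        μ (fun i => leftTransInv E g (leftTrans E g (b i))) := rfl
    have h3 : (fun i => leftTransInv E g (leftTrans E g (b i))) = b :=
      funext fun i => leftTransInv_leftTrans g (b i)
    rw [h1, h3]
    exact (AlternatingMap.map_basis_ne_zero_iff b μ).2 (hΦ.ne_zero 1)
  -- Vanishing divergence with respect to `h ν^l`; the `tr ad` of the trace formula cancels the one
  -- in the Lie derivative.
  have eq1 (g : G) : modChar P (leftDeriv E H g) =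
      lieTrace G (leftTriv P g) (leftDeriv E H g) / 2 -
        (h g)⁻¹ * leftDeriv E h g (sharpL E (leftTriv P g) (leftDeriv E H g)) := by
    have h1 := hpres Y hY g
    rw [hΦh, lieDerivative_smul_leftForm hΦ.top_degree.symm (Φ 1) (hh g).leftDiffAt
      (leftDiffAt_triv_hamiltonian hP hH g) hY, trace_leftDeriv_hamiltonian hP hH] at h1
    have h2 := (mul_eq_zero.1 h1).resolve_right (hb g)
    rw [triv_hamiltonian (hH g).leftDiffAt] at h2
    have h3 := hh0 g
    field_simp
    linarith
  have hπ := (leftDiffAt_leftTriv hP 1).hasFDerivAt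
  have hφ := (contMDiffAt_leftDeriv (hH 1)).leftDiffAt.hasFDerivAt
  have hs := (sharpL E).hasFDerivAt.comp (origin E G) hπ
  have e1 : leftTriv P (1 * param G (origin E G)) = 0 := by simp [leftTriv_one hP]
  have e2 : leftDeriv E H (1 * param G (origin E G)) = 0 := by simp [hc]
  -- A product of two factors that both vanish at the identity has zero derivative there; the same
  -- applies to `hu`.
  have hx : HasFDerivAt (fun v : E => sharpL E (leftTriv P (1 * param G v))
      (leftDeriv E H (1 * param G v))) (0 : E →L[ℝ] E) (origin E G) := by
    refine (hs.clm_apply hφ).congr_fderiv ?_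
    simp only [Function.comp_apply, e1, e2]
    simp
  have hu : HasFDerivAt (fun v : E => lieTrace G (leftTriv P (1 * param G v))
      (leftDeriv E H (1 * param G v))) (0 : E →L[ℝ] ℝ) (origin E G) := by
    have h1 := ((ContinuousLinearMap.compL ℝ E E ℝ).hasFDerivAt.comp (origin E G) hφ).clm_comp
      (hasFDerivAt_const (lieBr E G) (origin E G))
    have h2 := (trL E).hasFDerivAt.comp (origin E G) (hs.clm_comp h1)
    refine h2.congr_fderiv ?_
    simp only [Function.comp_apply, e1, e2]
    ext ξ
    simp
  have hk := (contMDiffAt_leftDeriv (hh 1)).leftDiffAt.hasFDerivAt.clm_apply hx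
  have hd : DifferentiableAt ℝ (fun v : E => h (1 * param G v)) (origin E G) :=
    (hh 1).leftDiffAt
  have hi := (hd.fun_inv (by simpa using hh0 1)).hasFDerivAt
  have hr := (hu.const_mul (1 / 2)).sub (hi.mul hk)
  have hl := (modChar P).hasFDerivAt.comp (origin E G) hφ
  have h1 := hl.unique (hr.congr_of_eventuallyEq (Eventually.of_forall fun v => by
    simp only [Function.comp_apply, eq1, Pi.sub_apply, Pi.mul_apply]
    ring))
  have h2 := congrArg (fun T : E →L[ℝ] ℝ => T ξ) h1
  simp only [e1, e2] at h2
  simpa using h2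

end ModularCharacter

/-! ### The Hessian at the identity and vanishing of the modular character -/

section Hessian

variable {E : Type*} [NormedAddCommGroup E] [NormedSpace ℝ E]
  {G : Type*} [TopologicalSpace G] [ChartedSpace E G] [Group G] [LieGroup 𝓘(ℝ, E) ∞ G]

theorem hessian_eq_leftDeriv {H : G → ℝ} (hH : IsSmoothFun E H) (ξ η : E) :
    hessian (E := E) (G := G) H ξ η = leftDeriv E (leftDeriv E H) (1 : G) ξ η := by
  have h1 : (fun g : G => diff E H g (mulInvariantVectorField (I := 𝓘(ℝ, E)) (G := G) η g)) =
      fun g => leftDeriv E H g η := funext fun g =>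
    DFunLike.congr_fun (mder_comp_leftTrans (hH g).leftDiffAt.mdifferentiableAt) η
  have h2 : HasFDerivAt (fun v : E => leftDeriv E H ((1 : G) * param G v) η)
      ((leftDeriv E (leftDeriv E H) (1 : G)).flip η) (origin E G) :=
    ((ContinuousLinearMap.apply ℝ ℝ η).hasFDerivAt.comp (origin E G)
      (contMDiffAt_leftDeriv (hH 1)).leftDiffAt.hasFDerivAt).congr_fderiv (by ext; rfl)
  have h3 : leftDeriv E (fun g => leftDeriv E H g η) (1 : G) =
      (leftDeriv E (leftDeriv E H) (1 : G)).flip η := h2.fderiv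
  have h4 : mder E ℝ (fun g => leftDeriv E H g η) (1 : G) ξ =
      leftDeriv E (leftDeriv E H) (1 : G) ξ η := by
    rw [leftDeriv_one (show LeftDiffAt E (fun g : G => leftDeriv E H g η) 1 from
      h2.differentiableAt), h3]
    rfl
  rw [← h4, ← h1]
  rfl

/-- Nondegeneracy makes `ξ ↦ Hess H(ξ, ·)` injective between spaces of equal dimension. -/
theorem surjective_leftDeriv_leftDeriv [FiniteDimensional ℝ E] {H : G → ℝ}
    (hH : IsMorseAtOne E H) :
    Function.Surjective (leftDeriv E (leftDeriv E H) (1 : G)) := by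
  have hinj : Function.Injective
      (leftDeriv E (leftDeriv E H) (1 : G) : E →ₗ[ℝ] (E →L[ℝ] ℝ)) := by
    refine (injective_iff_map_eq_zero _).2 fun ξ hξ => hH.separatingLeft ξ fun η => ?_
    exact (hessian_eq_leftDeriv hH.smooth ξ η).trans (DFunLike.congr_fun hξ η)
  have hdim : Module.finrank ℝ E = Module.finrank ℝ (E →L[ℝ] ℝ) := by
    rw [← (LinearMap.toContinuousLinearMap : (E →ₗ[ℝ] ℝ) ≃ₗ[ℝ] (E →L[ℝ] ℝ)).finrank_eq]
    exact Subspace.dual_finrank_eq.symm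
  exact (LinearMap.injective_iff_surjective_of_finrank_eq_finrank hdim).1 hinj

theorem modChar_eq_zero [FiniteDimensional ℝ E] [T2Space G] {n : ℕ} {P : TensorField2 E G}
    (hP : IsPoissonLie P) {H : G → ℝ} (hH : IsMorseAtOne E H)
    {Φ : ∀ g : G, Tan E g [⋀^Fin n]→ₗ[ℝ] ℝ} (hΦ : IsVolumeForm Φ)
    (hpres : Preserves (hamiltonian P H) Φ) : modChar P = 0 := by
  have hc : leftDeriv E H (1 : G) = 0 := by
    rw [← leftDeriv_one (hH.smooth 1).leftDiffAt]
    exact hH.critical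
  ext α
  obtain ⟨ξ, rfl⟩ := surjective_leftDeriv_leftDeriv hH α
  exact modChar_leftDeriv_leftDeriv hP hH.smooth hc hΦ hpres ξ

end Hessian

end

end PoissonLie

theorem theorem3p5
    {E : Type*} [NormedAddCommGroup E] [NormedSpace ℝ E] [FiniteDimensional ℝ E]
    {G : Type*} [TopologicalSpace G] [T2Space G] [ChartedSpace E G] [Group G]
    [LieGroup 𝓘(ℝ, E) ∞ G] [ConnectedSpace G]
    (n : ℕ) (hn : Module.finrank ℝ E = n)
    (P : PoissonLie.TensorField2 E G) (hP : PoissonLie.IsPoissonLie P)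
    (H : G → ℝ) (hH : PoissonLie.IsMorseAtOne E H)
    (hΦ : ∃ Φ : ∀ g : G, PoissonLie.Tan E g [⋀^Fin n]→ₗ[ℝ] ℝ,
      PoissonLie.IsVolumeForm Φ ∧ PoissonLie.Preserves (PoissonLie.hamiltonian P H) Φ) :
    PoissonLie.IsUnimodularDual P ∧
    ∀ ν : PoissonLie.LieAlg E G [⋀^Fin n]→ₗ[ℝ] ℝ, ν ≠ 0 →
      PoissonLie.IsVolumeForm
        (fun g : G => √(PoissonLie.f₀ E n g) • PoissonLie.leftForm ν g) ∧
      ∀ F : G → ℝ, PoissonLie.IsSmoothFun E F →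
        PoissonLie.Preserves (PoissonLie.hamiltonian P F)
          (fun g : G => √(PoissonLie.f₀ E n g) • PoissonLie.leftForm ν g) := by
  obtain ⟨Φ, hvol, hpres⟩ := hΦ
  have h0 : PoissonLie.modChar P = 0 := PoissonLie.modChar_eq_zero hP hH hvol hpres
  refine ⟨fun α => ?_, fun ν hν => ⟨PoissonLie.isVolumeForm_sqrt_f₀ hn hν, fun F hF =>
    PoissonLie.preserves_sqrt_f₀ hn hP h0 ν hF⟩⟩
  rw [PoissonLie.trace_dualAd hP, h0]
  rfl
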